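/- Let $z_0,z_1,z_2,\dots$ (the effective channel in the successive time slots) be i.i.d. nonnegative random variables with probability density function $f_Z$, let $F(s)=\int_0^\infty e^{-st}f_Z(t)\,dt$ be its Laplace transform, and let $\Theta>0$ (decoding threshold), $R>0$ (rate) and $\theta>0$ (QoS exponent). In persistent HARQ one packet is transmitted at a time, once per time slot, until the sum of the effective channels over its transmissions reaches $\Theta$; then it is decoded and the next packet is started in the next slot. Let $N_k$ be the number of packets decoded in the first $k$ slots. Put $Q_m=\mathbb P\{\sum_{i<m}z_i<\Theta\}$ and $P_m=Q_{m-1}-Q_m$ for $m\ge 1$. For HARQ truncated at $M$ transmissions, let $\mathbf A_M$ be the $M\times M$ companion matrix with first row $a_1,\dots,a_M$, ones on the subdiagonal and zeros elsewhere, where $a_m=P_me^{-\theta R}$ for $m<M$ and $a_M=P_Me^{-\theta R}+Q_M$. Then there is a number $\lambda_+\in(0,1)$, the spectral radius for persistent HARQ, such that the spectral radius of $\mathbf A_M$ converges to $\lambda_+$ as $M\to\infty$, and the effective capacity of persistent HARQ exists and is $$C_{\rm eff}=-\lim_{k\to\infty}\frac1{\theta k}\ln \mathbb E\{e^{-\theta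 R N_k}\}=-\frac{\ln\lambda_+}{\theta};$$ and $\lambda_+$ is implicitly given by $$e^{\theta R}=\mathcal L^{-1}_{\Theta}\left\{\frac1s\,\frac{1-F(s)}{\lambda_+-F(s)}\right\},$$ that is, it is the unique positive number that satisfies this equation. Here $\mathcal L^{-1}_x\{G(s)\}$ denotes the value at $x>0$ of the function that is continuous on $(0,\infty)$ and whose Laplace transform converges absolutely and equals $G(s)$ on some right half-plane. -/

import Mathlib

open MeasureTheory ProbabilityTheory Filter Topology Set

noncomputable section

namespace HARQ

/-- `f` is the probability density function of a nonnegative real random variable. -/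
structure IsChannelPdf (f : ℝ → ℝ) : Prop where
  measurable : Measurable f
  nonneg : ∀ x, 0 ≤ f x
  eq_zero_of_neg : ∀ x, x < 0 → f x = 0
  integral_eq_one : ∫ x, f x = 1

/-- `z 0, z 1, …` are i.i.d. real random variables with probability density function `f`:
`z i` is the effective channel seen in time slot `i`. -/
structure IsEffectiveChannel {Ω : Type*} [MeasurableSpace Ω] (P : Measure Ω)
    (f : ℝ → ℝ) (z : ℕ → Ω → ℝ) : Prop where
  measurable : ∀ i, Measurable (z i)
  law : ∀ i, P.map (z i) = volume.withDensity (fun x => ENNReal.ofReal (f x))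
  indep : iIndepFun z P

/-! ### Decoding probabilities and the truncated scheme -/

/-- `Q_m`: the probability that a packet is still not decoded after `m` transmissions, that is,
that the sum of `m` effective channels stays below the decoding threshold `Θ`. -/
def Q {Ω : Type*} [MeasurableSpace Ω] (P : Measure Ω) (z : ℕ → Ω → ℝ) (Θ : ℝ) (m : ℕ) : ℝ :=
  P.real {ω | ∑ i ∈ Finset.range m, z i ω < Θ}

/-- `P_m = Q_{m-1} - Q_m` for `m ≥ 1`: the probability that a packet is decoded at the `m`-th
transmission. (Only used for `m ≥ 1`.) -/
def decodeProb {Ω : Type*} [MeasurableSpace Ω] (P : Measure Ω) (z : ℕ → Ω → ℝ) (Θ : ℝ)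
    (m : ℕ) : ℝ :=
  Q P z Θ (m - 1) - Q P z Θ m

/-- The coefficients of HARQ truncated at `M` transmissions: `a_m = P_m e^{-θR}` for `m < M`, and
`a_M = P_M e^{-θR} + Q_M` (after `M` failures the packet is discarded). -/
def coeff {Ω : Type*} [MeasurableSpace Ω] (P : Measure Ω) (z : ℕ → Ω → ℝ) (Θ θ R : ℝ)
    (M m : ℕ) : ℝ :=
  decodeProb P z Θ m * Real.exp (-(θ * R)) + if m = M then Q P z Θ M else 0

/-- The `M × M` companion matrix of HARQ truncated at `M` transmissions: first row
`a_1, …, a_M`, ones on the subdiagonal, zeros elsewhere. -/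
def companion {Ω : Type*} [MeasurableSpace Ω] (P : Measure Ω) (z : ℕ → Ω → ℝ) (Θ θ R : ℝ)
    (M : ℕ) : Matrix (Fin M) (Fin M) ℂ :=
  Matrix.of fun i j =>
    if i.val = 0 then (coeff P z Θ θ R M (j.val + 1) : ℂ)
    else if j.val + 1 = i.val then 1 else 0

/-! ### The service process of persistent HARQ -/

/-- State of persistent HARQ after `k` time slots, for a realization `x` of the channel: the number
of packets decoded so far, and the sum of the effective channels accumulated for the packet that is
currently being transmitted. The packet is decoded in the slot in which the sum reaches `Θ`; then
the transmission of a new packet starts in the next slot. -/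
def state (Θ : ℝ) (x : ℕ → ℝ) : ℕ → ℕ × ℝ
  | 0 => (0, 0)
  | k + 1 =>
    if Θ ≤ (state Θ x k).2 + x k then ((state Θ x k).1 + 1, 0)
    else ((state Θ x k).1, (state Θ x k).2 + x k)

/-- `N_k`: the number of packets decoded in the first `k` time slots of persistent HARQ. -/
def numDecoded {Ω : Type*} (z : ℕ → Ω → ℝ) (Θ : ℝ) (k : ℕ) (ω : Ω) : ℕ :=
  (state Θ (fun i => z i ω) k).1

/-- `-(1 / (θ k)) ln E[e^{-θ R N_k}]`, whose limit as `k → ∞` is the effective capacity. -/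
def effCapacity {Ω : Type*} [MeasurableSpace Ω] (P : Measure Ω) (z : ℕ → Ω → ℝ) (Θ θ R : ℝ)
    (k : ℕ) : ℝ :=
  -(1 / (θ * k)) * Real.log (∫ ω, Real.exp (-(θ * R * numDecoded z Θ k ω)) ∂P)

/-! ### Laplace transform and its inverse -/

/-- The (one-sided) Laplace transform `∫₀^∞ e^{-st} h(t) dt`. -/
def laplace (h : ℝ → ℂ) (s : ℂ) : ℂ :=
  ∫ t in Ioi (0 : ℝ), Complex.exp (-(s * t)) * h t

/-- `h` is continuous on `(0, ∞)`, and its Laplace transform converges absolutely and equals `G`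
on some right half-plane. By Lerch's theorem, `G` determines `h` on `(0, ∞)`. -/
def IsLaplaceOriginal (G : ℂ → ℂ) (h : ℝ → ℂ) : Prop :=
  ContinuousOn h (Ioi 0) ∧
    ∃ c : ℝ, ∀ s : ℂ, c < s.re →
      IntegrableOn (fun t : ℝ => Complex.exp (-(s * t)) * h t) (Ioi 0) ∧ laplace h s = G s

open Classical in
/-- The inverse Laplace transform of `G` at `x > 0`: the value at `x` of the function that is
continuous on `(0, ∞)` and has Laplace transform `G` (and `0` if there is no such function). -/
def invLaplace (G : ℂ → ℂ) (x : ℝ) : ℂ :=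
  if hG : ∃ h : ℝ → ℂ, IsLaplaceOriginal G h then hG.choose x else 0

/-- The function `s ↦ (1/s) (1 - F(s)) / (lam - F(s))`, with `F` the Laplace transform of `f`. -/
def kernel (f : ℝ → ℝ) (lam : ℝ) (s : ℂ) : ℂ :=
  1 / s * ((1 - laplace (fun t => (f t : ℂ)) s) / (lam - laplace (fun t => (f t : ℂ)) s))

end HARQ

end

/-! Write `b = e^{-θR}`, `q m = Q_m`, and let `φ(x) = ∑_{m ≥ 1} P_m x^m` be the generating function
of the number of transmissions of a packet (`lifeGen`). All claims reduce to one equation, `b φ(1/λ)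
= 1`. Chernoff's bound makes `Q_m` decay faster than any geometric sequence, so `φ` is finite on
`[0, ∞)`; it is continuous, strictly increasing and unbounded there, with `φ(1) = 1`. As `b < 1`,
the equation has exactly one positive solution `λ`, and it lies in `(0, 1)`.

Effective capacity: decomposing by the slot in which the current packet started gives `E b^{N_k} =
∑_j r_j Q_{k-j}`, with `r` the renewal sequence of the weights `b P_m` (`lintegral_state`).
Comparison with geometric sequences gives growth rate `λ` (`renewal_upper`, `renewal_lower`),
without a renewal limit theorem.

Spectral radius: nonzero eigenvalues `μ` of the companion matrix solve `∑ a_m μ^{-m} = 1`. This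
differs from a truncation of `b φ(1/μ) = 1` only by `Q_M μ^{-M}`, which vanishes in the limit.

Implicit equation: `t ↦ P(z_0 + ⋯ + z_{k-1} < t)` has Laplace transform `F^k / s`. Summing a
geometric series shows that, for every `λ > 0`, the kernel is the transform of `φ(1/λ)` as a
function of the threshold (`isLaplaceOriginal_kernel`). By Lerch's theorem the implicit equation
says `φ(1/λ) = e^{θR}`, and monotonicity gives uniqueness. -/

noncomputable section

namespace HARQ

/-! ### The renewal sequence -/

/-- The renewal sequence `r 0 = 1`, `r (k + 1) = ∑_{j ≤ k} r j * p (k - j)`, where `p m` is the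
weight of an inter-arrival time `m + 1`. -/
def renewalSeq (p : ℕ → ℝ) : ℕ → ℝ
  | 0 => 1
  | k + 1 => ∑ j : Fin (k + 1), renewalSeq p j * p (k - j)

theorem renewalSeq_zero (p : ℕ → ℝ) : renewalSeq p 0 = 1 := by rw [renewalSeq]

theorem renewalSeq_succ (p : ℕ → ℝ) (k : ℕ) :
    renewalSeq p (k + 1) = ∑ j ∈ Finset.range (k + 1), renewalSeq p j * p (k - j) := by
  rw [renewalSeq, Finset.sum_range (fun j => renewalSeq p j * p (k - j))]

theorem renewalSeq_nonneg {p : ℕ → ℝ} (hp : ∀ m, 0 ≤ p m) (k : ℕ) : 0 ≤ renewalSeq p k := by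
  induction k using Nat.strong_induction_on with
  | _ k ih =>
    cases k with
    | zero => simp [renewalSeq_zero]
    | succ k =>
      rw [renewalSeq_succ]
      exact Finset.sum_nonneg fun j hj => mul_nonneg (ih j (Finset.mem_range.1 hj)) (hp _)

/-- The renewal equation for the convolution of the renewal sequence with `q`. -/
theorem renewal_equation {p q E : ℕ → ℝ}
    (hE : ∀ k, E k = ∑ j ∈ Finset.range (k + 1), renewalSeq p j * q (k - j)) (k : ℕ) :
    E (k + 1) = q (k + 1) + ∑ m ∈ Finset.range (k + 1), p m * E (k - m) := by
  -- In generating functions the recursion reads `r = 1 + X p r`; multiplying by `q` gives `E = q +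
  -- X p E`.
  have hr : PowerSeries.mk (renewalSeq p) =
      1 + PowerSeries.X * (PowerSeries.mk p * PowerSeries.mk (renewalSeq p)) := by
    ext n
    cases n with
    | zero => simp [renewalSeq_zero]
    | succ n =>
      rw [map_add, PowerSeries.coeff_succ_X_mul, PowerSeries.coeff_mk, renewalSeq_succ,
        mul_comm (PowerSeries.mk p), PowerSeries.coeff_mul,
        Finset.Nat.sum_antidiagonal_eq_sum_range_succ_mk]
      simp [PowerSeries.coeff_one]
  have hEs : PowerSeries.mk E = PowerSeries.mk (renewalSeq p) * PowerSeries.mk q := by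
    ext n
    rw [PowerSeries.coeff_mk, hE, PowerSeries.coeff_mul,
      Finset.Nat.sum_antidiagonal_eq_sum_range_succ_mk]
    simp
  have key : PowerSeries.mk E =
      PowerSeries.mk q + PowerSeries.X * (PowerSeries.mk p * PowerSeries.mk E) := by
    rw [hEs]
    conv_lhs => rw [hr]
    ring
  have := congrArg (PowerSeries.coeff (k + 1)) key
  rw [map_add, PowerSeries.coeff_succ_X_mul, PowerSeries.coeff_mul,
    Finset.Nat.sum_antidiagonal_eq_sum_range_succ_mk] at this
  simpa using this

/-! ### The characteristic equation -/

/-- A sequence of survival probabilities with a tail lighter than any exponential. -/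
structure IsSurvival (q : ℕ → ℝ) : Prop where
  nonneg : ∀ m, 0 ≤ q m
  antitone : Antitone q
  zero : q 0 = 1
  summable : ∀ x : ℝ, 0 ≤ x → Summable fun m => q m * x ^ m

/-- The generating function `∑_{m ≥ 1} (q (m - 1) - q m) x ^ m` of the life time. -/
def lifeGen (q : ℕ → ℝ) (x : ℝ) : ℝ := ∑' m, (q m - q (m + 1)) * x ^ (m + 1)

namespace IsSurvival

variable {q : ℕ → ℝ}

theorem sub_nonneg (hq : IsSurvival q) (m : ℕ) : 0 ≤ q m - q (m + 1) :=
  _root_.sub_nonneg.2 (hq.antitone m.le_succ)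

theorem term_le (hq : IsSurvival q) {x T : ℝ} (hx : 0 ≤ x) (hxT : x ≤ T) (m : ℕ) :
    (q m - q (m + 1)) * x ^ (m + 1) ≤ T * (q m * T ^ m) := by
  have h1 : (q m - q (m + 1)) * x ^ (m + 1) ≤ q m * T ^ (m + 1) :=
    mul_le_mul (by linarith [hq.nonneg (m + 1)]) (pow_le_pow_left₀ hx hxT _)
      (pow_nonneg hx _) (hq.nonneg _)
  calc _ ≤ _ := h1
    _ = _ := by ring

theorem term_nonneg (hq : IsSurvival q) {x : ℝ} (hx : 0 ≤ x) (m : ℕ) :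
    0 ≤ (q m - q (m + 1)) * x ^ (m + 1) :=
  mul_nonneg (hq.sub_nonneg m) (pow_nonneg hx _)

theorem summable_term (hq : IsSurvival q) {x : ℝ} (hx : 0 ≤ x) :
    Summable fun m => (q m - q (m + 1)) * x ^ (m + 1) :=
  Summable.of_nonneg_of_le (hq.term_nonneg hx) (hq.term_le hx le_rfl)
    ((hq.summable x hx).mul_left x)

theorem tendsto_zero (hq : IsSurvival q) : Tendsto q atTop (𝓝 0) := by
  simpa using (hq.summable 1 zero_le_one).tendsto_atTop_zero

theorem lifeGen_one (hq : IsSurvival q) : lifeGen q 1 = 1 := by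
  have h := (hq.summable_term zero_le_one).hasSum.tendsto_sum_nat
  have h2 : Tendsto (fun n => ∑ m ∈ Finset.range n, (q m - q (m + 1)) * (1 : ℝ) ^ (m + 1))
      atTop (𝓝 (1 - 0)) := by
    have : ∀ n, ∑ m ∈ Finset.range n, (q m - q (m + 1)) * (1 : ℝ) ^ (m + 1) = 1 - q n := by
      intro n
      simp only [one_pow, mul_one]
      rw [Finset.sum_range_sub', hq.zero]
    simp_rw [this]
    exact tendsto_const_nhds.sub hq.tendsto_zero
  simpa [lifeGen] using tendsto_nhds_unique h h2

/-- The life-time probabilities have total mass 1. One positive coefficient suffices for strict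
monotonicity and unboundedness of the generating function. -/
theorem exists_pos (hq : IsSurvival q) : ∃ m, 0 < q m - q (m + 1) := by
  by_contra! h
  have : lifeGen q 1 = 0 := by
    have h0 : ∀ m, q m - q (m + 1) = 0 := fun m => le_antisymm (h m) (hq.sub_nonneg m)
    simp [lifeGen, h0]
  rw [hq.lifeGen_one] at this
  exact one_ne_zero this

theorem lifeGen_strictMonoOn (hq : IsSurvival q) : StrictMonoOn (lifeGen q) (Ici 0) := by
  intro x hx y hy hxy
  obtain ⟨m, hm⟩ := hq.exists_pos
  refine Summable.tsum_lt_tsum (i := m) (fun n => ?_) ?_ (hq.summable_term hx) (hq.summable_term hy)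
  · exact mul_le_mul_of_nonneg_left (pow_le_pow_left₀ hx hxy.le _) (hq.sub_nonneg n)
  · exact mul_lt_mul_of_pos_left (pow_lt_pow_left₀ hxy hx (Nat.succ_ne_zero _)) hm

theorem lifeGen_continuousOn (hq : IsSurvival q) (T : ℝ) :
    ContinuousOn (lifeGen q) (Icc 0 T) := by
  by_cases hT : 0 ≤ T
  · refine continuousOn_tsum (u := fun m => T * (q m * T ^ m)) (fun m => by fun_prop)
      ((hq.summable T hT).mul_left T) fun m x hx => ?_
    rw [Real.norm_of_nonneg (hq.term_nonneg hx.1 m)]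
    exact hq.term_le hx.1 hx.2 m
  · rw [Icc_eq_empty hT]
    exact continuousOn_empty _

theorem exists_lifeGen_eq (hq : IsSurvival q) {B : ℝ} (hB : 1 < B) :
    ∃ lam, 0 < lam ∧ lam < 1 ∧ lifeGen q lam⁻¹ = B := by
  obtain ⟨m, hm⟩ := hq.exists_pos
  -- With this `T` the single term of index `m` already reaches `B`, since `T ^ (m + 1) ≥ T`.
  set T := max 1 (B / (q m - q (m + 1))) with hT
  have hT1 : 1 ≤ T := le_max_left _ _
  have hBT : B ≤ lifeGen q T := by
    calc B ≤ (q m - q (m + 1)) * T := by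
          rw [mul_comm, ← div_le_iff₀ hm]
          exact le_max_right _ _
      _ ≤ (q m - q (m + 1)) * T ^ (m + 1) :=
          mul_le_mul_of_nonneg_left (le_self_pow₀ hT1 (Nat.succ_ne_zero _)) hm.le
      _ ≤ _ := (hq.summable_term (by linarith)).le_tsum m
          fun j _ => hq.term_nonneg (by linarith) j
  obtain ⟨x, hx, hxB⟩ := intermediate_value_Icc hT1
    ((hq.lifeGen_continuousOn T).mono (Icc_subset_Icc_left zero_le_one))
    (show B ∈ Icc _ _ from ⟨by rw [hq.lifeGen_one]; exact hB.le, hBT⟩)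
  have hx1 : 1 < x := by
    refine lt_of_le_of_ne hx.1 fun h => ?_
    rw [← h, hq.lifeGen_one] at hxB
    exact hB.ne hxB
  exact ⟨x⁻¹, by positivity, inv_lt_one_of_one_lt₀ hx1, by rwa [inv_inv]⟩

theorem lifeGen_inv_injOn (hq : IsSurvival q) {x y : ℝ} (hx : 0 < x) (hy : 0 < y)
    (h : lifeGen q x⁻¹ = lifeGen q y⁻¹) : x = y :=
  inv_injective (hq.lifeGen_strictMonoOn.injOn (inv_pos.2 hx).le (inv_pos.2 hy).le h)

/-! ### Exponential growth rate of the renewal process -/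

/-- Below `lam` the tilted weights `b P_m l^{-m}` have total mass above 1, so finitely many of them
already do. Both lower bounds, for the renewal process and for the spectral radius, rest on this. -/
theorem exists_le_sum {lam l b : ℝ} (hq : IsSurvival q) (hl : 0 < l) (hlt : l < lam)
    (hb : 0 < b) (h : lifeGen q lam⁻¹ = b⁻¹) :
    ∃ L, ∀ M, L ≤ M →
      1 < ∑ m ∈ Finset.range M, b * (q m - q (m + 1)) * l⁻¹ ^ (m + 1) := by
  have hl' : 0 ≤ l⁻¹ := (inv_pos.2 hl).le
  have h1 : b⁻¹ < lifeGen q l⁻¹ := by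
    rw [← h]
    exact hq.lifeGen_strictMonoOn (inv_pos.2 (hl.trans hlt)).le hl' (inv_strictAnti₀ hl hlt)
  have h2 := (hq.summable_term hl').hasSum.tendsto_sum_nat.eventually (lt_mem_nhds h1)
  obtain ⟨L, hL⟩ := eventually_atTop.1 h2
  refine ⟨L, fun M hM => ?_⟩
  simp_rw [mul_assoc b]
  rw [← Finset.mul_sum]
  have := mul_lt_mul_of_pos_left (hL M hM) hb
  rwa [mul_inv_cancel₀ hb.ne'] at this

/-- The weights `b P_m lam^{-m}` sum to 1, so the recursion bounds `r_k lam^{-k}` by a sub-average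
of earlier values. -/
theorem renewalSeq_le {lam b : ℝ} (hq : IsSurvival q) (hlam : 0 < lam) (hb : 0 < b)
    (h : lifeGen q lam⁻¹ = b⁻¹) (k : ℕ) :
    renewalSeq (fun m => b * (q m - q (m + 1))) k ≤ lam ^ k := by
  induction k using Nat.strong_induction_on with
  | _ k ih =>
    cases k with
    | zero => simp [renewalSeq_zero]
    | succ k =>
      rw [renewalSeq_succ]
      have hl' : 0 ≤ lam⁻¹ := (inv_pos.2 hlam).le
      calc _ ≤ ∑ j ∈ Finset.range (k + 1),
            lam ^ (k + 1) * b * ((q (k - j) - q (k - j + 1)) * lam⁻¹ ^ (k - j + 1)) := by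
            refine Finset.sum_le_sum fun j hj => ?_
            have hj' := Finset.mem_range.1 hj
            have e : lam ^ (k + 1) = lam ^ j * lam ^ (k - j + 1) := by
              rw [← pow_add]; congr 1; omega
            calc _ ≤ lam ^ j * (b * (q (k - j) - q (k - j + 1))) :=
                  mul_le_mul_of_nonneg_right (ih j hj') (mul_nonneg hb.le (hq.sub_nonneg _))
              _ = _ := by
                  rw [e, inv_pow]
                  field_simp
        _ = lam ^ (k + 1) * b *
            ∑ j ∈ Finset.range (k + 1), ((q j - q (j + 1)) * lam⁻¹ ^ (j + 1)) := by
            rw [← Finset.mul_sum, Finset.sum_range_reflect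
              (fun j => (q j - q (j + 1)) * lam⁻¹ ^ (j + 1)) (k + 1) |>.symm]
            simp
        _ ≤ lam ^ (k + 1) * b * b⁻¹ := by
            refine mul_le_mul_of_nonneg_left ?_ (by positivity)
            rw [← h]
            exact (hq.summable_term hl').sum_le_tsum _ fun j _ => hq.term_nonneg hl' j
        _ = _ := by rw [mul_assoc, mul_inv_cancel₀ hb.ne', mul_one]

theorem renewal_upper {lam b : ℝ} {E : ℕ → ℝ} (hq : IsSurvival q) (hlam : 0 < lam) (hb : 0 < b)
    (h : lifeGen q lam⁻¹ = b⁻¹)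
    (hE : ∀ k, E k = ∑ j ∈ Finset.range (k + 1),
      renewalSeq (fun m => b * (q m - q (m + 1))) j * q (k - j)) :
    ∃ C, 0 < C ∧ ∀ k, E k ≤ C * lam ^ k := by
  have hl' : 0 ≤ lam⁻¹ := (inv_pos.2 hlam).le
  have hs := hq.summable _ hl'
  have hnn : ∀ m, 0 ≤ q m * lam⁻¹ ^ m := fun m => mul_nonneg (hq.nonneg m) (pow_nonneg hl' _)
  -- The `+ 1` only makes positivity of the constant immediate.
  refine ⟨∑' m, q m * lam⁻¹ ^ m + 1, by
    have h0 : 0 ≤ ∑' m, q m * lam⁻¹ ^ m := tsum_nonneg hnn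
    linarith, fun k => ?_⟩
  rw [hE]
  calc _ ≤ ∑ j ∈ Finset.range (k + 1), lam ^ k * (q (k - j) * lam⁻¹ ^ (k - j)) := by
        refine Finset.sum_le_sum fun j hj => ?_
        have hj' := Finset.mem_range.1 hj
        have e : lam ^ k = lam ^ j * lam ^ (k - j) := by
          rw [← pow_add]; congr 1; omega
        calc _ ≤ lam ^ j * q (k - j) :=
              mul_le_mul_of_nonneg_right (hq.renewalSeq_le hlam hb h j) (hq.nonneg _)
          _ = _ := by
              rw [e, inv_pow]
              field_simp
    _ = lam ^ k * ∑ j ∈ Finset.range (k + 1), q j * lam⁻¹ ^ j := by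
        rw [← Finset.mul_sum, Finset.sum_range_reflect (fun j => q j * lam⁻¹ ^ j) (k + 1) |>.symm]
        simp
    _ ≤ lam ^ k * (∑' m, q m * lam⁻¹ ^ m + 1) := by
        refine mul_le_mul_of_nonneg_left ?_ (by positivity)
        have := hs.sum_le_tsum (Finset.range (k + 1)) fun j _ => hnn j
        linarith
    _ = _ := mul_comm _ _

/-- Once the tilted weights up to `k` have mass above 1, the renewal equation propagates `c * l ^ k
≤ E k` by induction. The constant is the minimum of `E k / l ^ k` over the initial stretch. -/
theorem renewal_lower {lam l b : ℝ} {E : ℕ → ℝ} (hq : IsSurvival q) (hl : 0 < l)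
    (hlt : l < lam) (hb : 0 < b) (h : lifeGen q lam⁻¹ = b⁻¹)
    (hE : ∀ k, E k = ∑ j ∈ Finset.range (k + 1),
      renewalSeq (fun m => b * (q m - q (m + 1))) j * q (k - j))
    (hpos : ∀ k, 0 < E k) :
    ∃ c, 0 < c ∧ ∀ k, c * l ^ k ≤ E k := by
  obtain ⟨L, hL⟩ := hq.exists_le_sum hl hlt hb h
  obtain ⟨k₀, -, hk₀⟩ := Finset.exists_min_image (Finset.range (L + 1)) (fun k => E k / l ^ k)
    ⟨0, by simp⟩
  have hc : 0 < E k₀ / l ^ k₀ := div_pos (hpos _) (pow_pos hl _)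
  refine ⟨E k₀ / l ^ k₀, hc, fun k => ?_⟩
  set c := E k₀ / l ^ k₀
  induction k using Nat.strong_induction_on with
  | _ k ih =>
    by_cases hk : k < L + 1
    · rw [← le_div_iff₀ (pow_pos hl _)]
      exact hk₀ k (Finset.mem_range.2 hk)
    · obtain ⟨n, rfl⟩ : ∃ n, k = n + 1 := ⟨k - 1, by omega⟩
      rw [renewal_equation hE]
      have hsum := hL (n + 1) (by omega)
      calc c * l ^ (n + 1) ≤ c * l ^ (n + 1) *
            ∑ m ∈ Finset.range (n + 1), b * (q m - q (m + 1)) * l⁻¹ ^ (m + 1) :=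
            le_mul_of_one_le_right (by positivity) hsum.le
        _ = ∑ m ∈ Finset.range (n + 1), b * (q m - q (m + 1)) * (c * l ^ (n - m)) := by
            rw [Finset.mul_sum]
            refine Finset.sum_congr rfl fun m hm => ?_
            have hm' := Finset.mem_range.1 hm
            have e : l ^ (n + 1) = l ^ (n - m) * l ^ (m + 1) := by
              rw [← pow_add]; congr 1; omega
            rw [e, inv_pow]
            field_simp
        _ ≤ ∑ m ∈ Finset.range (n + 1), b * (q m - q (m + 1)) * E (n - m) := by
            refine Finset.sum_le_sum fun m hm => ?_
            exact mul_le_mul_of_nonneg_left (ih _ (by omega))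
              (mul_nonneg hb.le (hq.sub_nonneg _))
        _ ≤ _ := le_add_of_nonneg_left (hq.nonneg _)

theorem tendsto_log_div {lam b : ℝ} {E : ℕ → ℝ} (hq : IsSurvival q) (hlam : 0 < lam)
    (hb : 0 < b) (h : lifeGen q lam⁻¹ = b⁻¹)
    (hE : ∀ k, E k = ∑ j ∈ Finset.range (k + 1),
      renewalSeq (fun m => b * (q m - q (m + 1))) j * q (k - j))
    (hpos : ∀ k, 0 < E k) :
    Tendsto (fun k : ℕ => Real.log (E k) / k) atTop (𝓝 (Real.log lam)) := by
  have hlin : ∀ c d : ℝ, Tendsto (fun k : ℕ => c / k + d) atTop (𝓝 d) := fun c d => by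
    simpa using (tendsto_const_div_atTop_nhds_zero_nat c).add_const d
  have hlog : ∀ {c d : ℝ} {k : ℕ}, 0 < c → 0 < d → 0 < k →
      Real.log (c * d ^ k) / k = Real.log c / k + Real.log d := fun {c d k} hc hd hk => by
    rw [Real.log_mul hc.ne' (pow_pos hd _).ne', Real.log_pow]
    field_simp
  rw [tendsto_order]
  constructor
  · intro a ha
    -- The gap between `a` and `a'` absorbs `log c / k` for large `k`.
    obtain ⟨a', haa', ha'⟩ := exists_between ha
    have hlt : Real.exp a' < lam := (Real.lt_log_iff_exp_lt hlam).1 ha'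
    obtain ⟨c, hc, hcE⟩ := hq.renewal_lower (Real.exp_pos a') hlt hb h hE hpos
    filter_upwards [(hlin (Real.log c) a').eventually (lt_mem_nhds haa'), eventually_gt_atTop 0]
      with k hk hk0
    refine hk.trans_le ?_
    have hlog' := hlog hc (Real.exp_pos a') hk0
    rw [Real.log_exp] at hlog'
    rw [← hlog']
    gcongr
    exact hcE k
  · intro a ha
    obtain ⟨C, hC, hCE⟩ := hq.renewal_upper hlam hb h hE
    filter_upwards [(hlin (Real.log C) (Real.log lam)).eventually (gt_mem_nhds ha),
      eventually_gt_atTop 0] with k hk hk0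
    refine lt_of_le_of_lt ?_ hk
    rw [← hlog hC hlam hk0]
    gcongr
    · exact hpos k
    · exact hCE k

end IsSurvival

/-! ### Spectral radius of a nonnegative companion matrix -/

/-- The `M × M` matrix with first row `a 0, …, a (M - 1)`, ones on the subdiagonal and zeros
elsewhere. -/
def rowCompanion (a : ℕ → ℝ) (M : ℕ) : Matrix (Fin M) (Fin M) ℂ :=
  Matrix.of fun i j => if i.val = 0 then (a j.val : ℂ) else if j.val + 1 = i.val then 1 else 0

theorem rowCompanion_mulVec_zero (a : ℕ → ℝ) (n : ℕ) (v : Fin (n + 1) → ℂ) :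
    (rowCompanion a (n + 1)).mulVec v 0 = ∑ j, (a j.val : ℂ) * v j := by
  simp [rowCompanion, Matrix.mulVec, dotProduct]

theorem rowCompanion_mulVec_succ (a : ℕ → ℝ) (n : ℕ) (v : Fin (n + 1) → ℂ) (i : Fin n) :
    (rowCompanion a (n + 1)).mulVec v i.succ = v i.castSucc := by
  have h : ∀ j : Fin (n + 1), (j.val = i.val) = (j = i.castSucc) := fun j => by
    simp [Fin.ext_iff]
  simp [rowCompanion, Matrix.mulVec, dotProduct, h]

/-- The vector `(x ^ j)` is an eigenvector for `x⁻¹`: the lower rows shift it, and the first row is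
the hypothesis. -/
theorem le_spectralRadius_rowCompanion {a : ℕ → ℝ} {n : ℕ} {x : ℝ} (hx : 0 < x)
    (h : ∑ j ∈ Finset.range (n + 1), a j * x ^ (j + 1) = 1) :
    ENNReal.ofReal x⁻¹ ≤ spectralRadius ℂ (rowCompanion a (n + 1)) := by
  have hxc : (x : ℂ) ≠ 0 := by exact_mod_cast hx.ne'
  have hmem : ((x⁻¹ : ℝ) : ℂ) ∈ spectrum ℂ (rowCompanion a (n + 1)) := by
    rw [← Matrix.spectrum_toLin', ← Module.End.hasEigenvalue_iff_mem_spectrum]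
    refine Module.End.hasEigenvalue_of_hasEigenvector
      (x := fun j : Fin (n + 1) => (x : ℂ) ^ j.val) ⟨Module.End.mem_eigenspace_iff.2 ?_, ?_⟩
    · rw [Matrix.toLin'_apply]
      funext i
      refine Fin.cases ?_ (fun i => ?_) i
      · rw [rowCompanion_mulVec_zero, Fin.sum_univ_eq_sum_range (fun j => (a j : ℂ) * (x : ℂ) ^ j)]
        have h' : (x : ℂ) * ∑ j ∈ Finset.range (n + 1), (a j : ℂ) * (x : ℂ) ^ j = 1 := by
          rw [← Complex.ofReal_one, ← h, Finset.mul_sum]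
          push_cast
          exact Finset.sum_congr rfl fun j _ => by ring
        simp [eq_inv_of_mul_eq_one_right h']
      · rw [rowCompanion_mulVec_succ]
        simp [pow_succ]
        field_simp
    · intro h0
      simpa using congrFun h0 0
  refine le_trans (le_of_eq ?_) (le_iSup₂ (f := fun k (_ : k ∈ _) => (‖k‖₊ : ENNReal)) _ hmem)
  rw [← enorm_eq_nnnorm, ← ofReal_norm, Complex.norm_real, Real.norm_of_nonneg (inv_pos.2 hx).le]

/-- An eigenvector for `μ ≠ 0` must be a multiple of `(μ^{-j})`, so `∑ a_j μ^{-(j+1)} = 1`. If `|μ|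
> x⁻¹`, the triangle inequality and `a ≥ 0` contradict the hypothesis. -/
theorem spectralRadius_rowCompanion_le {a : ℕ → ℝ} (ha : ∀ j, 0 ≤ a j) {n : ℕ} {x : ℝ}
    (hx : 0 < x) (h : ∑ j ∈ Finset.range (n + 1), a j * x ^ (j + 1) < 1) :
    spectralRadius ℂ (rowCompanion a (n + 1)) ≤ ENNReal.ofReal x⁻¹ := by
  refine iSup₂_le fun μ hμ => ?_
  rw [← enorm_eq_nnnorm, ← ofReal_norm]
  refine ENNReal.ofReal_le_ofReal ?_
  rw [← Matrix.spectrum_toLin', ← Module.End.hasEigenvalue_iff_mem_spectrum] at hμ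
  obtain ⟨v, hv, hv0⟩ := hμ.exists_hasEigenvector
  rw [Module.End.mem_eigenspace_iff, Matrix.toLin'_apply] at hv
  by_contra! hlt
  have hμpos : 0 < ‖μ‖ := (inv_pos.2 hx).trans hlt
  have hμ0 : μ ≠ 0 := norm_pos_iff.1 hμpos
  have hvj : ∀ j : Fin (n + 1), v j = μ⁻¹ ^ j.val * v 0 := by
    intro j
    induction j using Fin.induction with
    | zero => simp
    | succ i ih =>
      have := congrFun hv i.succ
      rw [rowCompanion_mulVec_succ, Pi.smul_apply, smul_eq_mul, ih] at this
      rw [Fin.val_succ, pow_succ, mul_right_comm, ← Fin.val_castSucc i, this]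
      field_simp
  have hv00 : v 0 ≠ 0 := fun h0 => hv0 (funext fun j => by rw [hvj, h0]; simp)
  have h0 := congrFun hv 0
  rw [rowCompanion_mulVec_zero, Pi.smul_apply, smul_eq_mul] at h0
  have h1 : ∑ j ∈ Finset.range (n + 1), (a j : ℂ) * μ⁻¹ ^ (j + 1) = 1 := by
    refine mul_right_cancel₀ (mul_ne_zero hμ0 hv00) ?_
    rw [one_mul, Finset.sum_mul, ← Fin.sum_univ_eq_sum_range
      (fun j => (a j : ℂ) * μ⁻¹ ^ (j + 1) * (μ * v 0))]
    conv_rhs => rw [← h0]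
    refine Finset.sum_congr rfl fun j _ => ?_
    rw [hvj j, pow_succ]
    field_simp
  have h2 : (1 : ℝ) ≤ ∑ j ∈ Finset.range (n + 1), a j * x ^ (j + 1) := by
    calc (1 : ℝ) = ‖∑ j ∈ Finset.range (n + 1), (a j : ℂ) * μ⁻¹ ^ (j + 1)‖ := by rw [h1, norm_one]
      _ ≤ ∑ j ∈ Finset.range (n + 1), ‖(a j : ℂ) * μ⁻¹ ^ (j + 1)‖ := norm_sum_le _ _
      _ ≤ _ := by
        refine Finset.sum_le_sum fun j _ => ?_
        rw [norm_mul, norm_pow, norm_inv, Complex.norm_real, Real.norm_of_nonneg (ha j)]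
        exact mul_le_mul_of_nonneg_left (pow_le_pow_left₀ (inv_nonneg.2 hμpos.le)
          (inv_le_of_inv_le₀ hx hlt.le) _) (ha j)
  linarith

/-- The first row of the companion matrix of the truncated scheme. -/
def truncRow (q : ℕ → ℝ) (b : ℝ) (M j : ℕ) : ℝ :=
  b * (q j - q (j + 1)) + if j + 1 = M then q M else 0

theorem sum_truncRow (q : ℕ → ℝ) (b x : ℝ) (n : ℕ) :
    ∑ j ∈ Finset.range (n + 1), truncRow q b (n + 1) j * x ^ (j + 1) =
      ∑ j ∈ Finset.range (n + 1), b * (q j - q (j + 1)) * x ^ (j + 1) +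
        q (n + 1) * x ^ (n + 1) := by
  simp_rw [truncRow, add_mul, Finset.sum_add_distrib]
  congr 1
  rw [Finset.sum_eq_single n]
  · simp
  · intro j _ hj
    simp [hj]
  · simp

namespace IsSurvival

variable {q : ℕ → ℝ}

theorem truncRow_nonneg (hq : IsSurvival q) {b : ℝ} (hb : 0 < b) (M j : ℕ) :
    0 ≤ truncRow q b M j := by
  refine add_nonneg (mul_nonneg hb.le (hq.sub_nonneg j)) ?_
  split_ifs
  · exact hq.nonneg M
  · exact le_rfl

theorem eventually_le_spectralRadius {lam l b : ℝ} (hq : IsSurvival q) (hl : 0 < l)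
    (hlt : l < lam) (hlam1 : lam < 1) (hb : 0 < b) (hb1 : b ≤ 1) (h : lifeGen q lam⁻¹ = b⁻¹) :
    ∀ᶠ M in atTop, ENNReal.ofReal l ≤ spectralRadius ℂ (rowCompanion (truncRow q b M) M) := by
  obtain ⟨L, hL⟩ := hq.exists_le_sum hl hlt hb h
  filter_upwards [eventually_ge_atTop (L + 1)] with M hM
  obtain ⟨n, rfl⟩ : ∃ n, M = n + 1 := ⟨M - 1, by omega⟩
  -- At `x = 1` the row sum telescopes to `b (1 - Q_M) + Q_M ≤ 1`, and at `l⁻¹` it is at least 1; a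
  -- root in between gives an eigenvalue at least `l`.
  have h1 : ∑ j ∈ Finset.range (n + 1), truncRow q b (n + 1) j * (1 : ℝ) ^ (j + 1) ≤ 1 := by
    rw [sum_truncRow]
    simp only [one_pow, mul_one]
    rw [← Finset.mul_sum, Finset.sum_range_sub', hq.zero]
    have hle : q (n + 1) ≤ 1 := hq.zero ▸ hq.antitone (Nat.zero_le _)
    nlinarith
  have h2 : 1 ≤ ∑ j ∈ Finset.range (n + 1), truncRow q b (n + 1) j * l⁻¹ ^ (j + 1) := by
    rw [sum_truncRow]
    have := hL (n + 1) (by omega)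
    have := mul_nonneg (hq.nonneg (n + 1)) (pow_nonneg (inv_pos.2 hl).le (n + 1))
    linarith
  obtain ⟨y, hy, hy1⟩ := intermediate_value_Icc
    (f := fun x : ℝ => ∑ j ∈ Finset.range (n + 1), truncRow q b (n + 1) j * x ^ (j + 1))
    (one_le_inv₀ hl |>.2 (hlt.trans hlam1).le) (by fun_prop) ⟨h1, h2⟩
  have hy0 : 0 < y := zero_lt_one.trans_le hy.1
  exact (ENNReal.ofReal_le_ofReal ((le_inv_comm₀ hl hy0).2 hy.2)).trans
    (le_spectralRadius_rowCompanion hy0 hy1)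

theorem eventually_spectralRadius_le {lam l b : ℝ} (hq : IsSurvival q) (hlam : 0 < lam)
    (hlt : lam < l) (hb : 0 < b) (h : lifeGen q lam⁻¹ = b⁻¹) :
    ∀ᶠ M in atTop, spectralRadius ℂ (rowCompanion (truncRow q b M) M) ≤ ENNReal.ofReal l := by
  have hl : 0 < l := hlam.trans hlt
  have hl' : 0 ≤ l⁻¹ := (inv_pos.2 hl).le
  have hG : b * lifeGen q l⁻¹ + 0 < 1 := by
    have : lifeGen q l⁻¹ < b⁻¹ := by
      rw [← h]
      exact hq.lifeGen_strictMonoOn hl' (inv_pos.2 hlam).le (inv_strictAnti₀ hlam hlt)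
    have := mul_lt_mul_of_pos_left this hb
    rwa [mul_inv_cancel₀ hb.ne', ← add_zero (b * _)] at this
  -- The `+ 0` is the limit of the discarding term `q M * l⁻¹ ^ M`.
  have ht : Tendsto (fun M => b * ∑ j ∈ Finset.range M, (q j - q (j + 1)) * l⁻¹ ^ (j + 1) +
      q M * l⁻¹ ^ M) atTop (𝓝 (b * lifeGen q l⁻¹ + 0)) :=
    ((hq.summable_term hl').hasSum.tendsto_sum_nat.const_mul b).add
      (hq.summable _ hl').tendsto_atTop_zero
  filter_upwards [ht.eventually (gt_mem_nhds hG), eventually_ge_atTop 1] with M hM hM1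
  obtain ⟨n, rfl⟩ : ∃ n, M = n + 1 := ⟨M - 1, by omega⟩
  rw [← inv_inv l]
  refine spectralRadius_rowCompanion_le (hq.truncRow_nonneg hb _) (inv_pos.2 hl) ?_
  rw [sum_truncRow]
  simp_rw [mul_assoc b]
  rwa [← Finset.mul_sum]

theorem tendsto_spectralRadius {lam b : ℝ} (hq : IsSurvival q) (hlam : 0 < lam)
    (hlam1 : lam < 1) (hb : 0 < b) (hb1 : b ≤ 1) (h : lifeGen q lam⁻¹ = b⁻¹) :
    Tendsto (fun M => spectralRadius ℂ (rowCompanion (truncRow q b M) M)) atTop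
      (𝓝 (ENNReal.ofReal lam)) := by
  have hcont := ENNReal.continuous_ofReal.tendsto lam
  rw [tendsto_order]
  constructor
  · intro a ha
    obtain ⟨l, ⟨hal, hl0⟩, hl⟩ := (((hcont.eventually (lt_mem_nhds ha)).and
      (lt_mem_nhds hlam)).filter_mono nhdsWithin_le_nhds |>.and
        (self_mem_nhdsWithin (s := Iio lam))).exists
    filter_upwards [hq.eventually_le_spectralRadius hl0 hl hlam1 hb hb1 h] with M hM
    exact hal.trans_le hM
  · intro a ha
    obtain ⟨l, hal, hl⟩ := ((hcont.eventually (gt_mem_nhds ha)).filter_mono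
      nhdsWithin_le_nhds |>.and (self_mem_nhdsWithin (s := Ioi lam))).exists
    filter_upwards [hq.eventually_spectralRadius_le hlam hl hb h] with M hM
    exact hM.trans_lt hal

end IsSurvival

/-! ### Uniqueness of the inverse Laplace transform -/

open FourierTransform in
/-- **Lerch's theorem** for functions that are continuous on `(0, ∞)`. -/
theorem IsLaplaceOriginal.eqOn {G : ℂ → ℂ} {h₁ h₂ : ℝ → ℂ} (H₁ : IsLaplaceOriginal G h₁)
    (H₂ : IsLaplaceOriginal G h₂) {x : ℝ} (hx : 0 < x) : h₁ x = h₂ x := by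
  obtain ⟨hc₁, c₁, hL₁⟩ := H₁
  obtain ⟨hc₂, c₂, hL₂⟩ := H₂
  set σ := max c₁ c₂ + 1 with hσ
  have hσ₁ : c₁ < σ := by have := le_max_left c₁ c₂; linarith
  have hσ₂ : c₂ < σ := by have := le_max_right c₁ c₂; linarith
  -- The Fourier transform of this damped difference is the difference of the two Laplace transforms
  -- on the line `Re s = σ`, hence zero. Fourier inversion at the continuity point `x` then gives `g
  -- x = 0`.
  set g : ℝ → ℂ := (Ioi 0).indicator fun t => Complex.exp (-(σ * t)) * (h₁ t - h₂ t) with hg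
  have hgint : Integrable g := by
    rw [hg, integrable_indicator_iff measurableSet_Ioi]
    have := (hL₁ σ (by simpa using hσ₁)).1.sub (hL₂ σ (by simpa using hσ₂)).1
    refine this.congr (Eventually.of_forall fun t => ?_)
    simp [mul_sub]
  have hF : 𝓕 g = 0 := by
    funext w
    rw [Real.fourier_real_eq_integral_exp_smul]
    set s : ℂ := σ + 2 * Real.pi * w * Complex.I with hs
    have hsre : s.re = σ := by simp [hs]
    have e : ∀ v : ℝ, Complex.exp (↑(-2 * Real.pi * v * w) * Complex.I) • g v =
        (Ioi (0 : ℝ)).indicator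
          (fun t : ℝ => Complex.exp (-(s * t)) * h₁ t - Complex.exp (-(s * t)) * h₂ t) v := by
      intro v
      by_cases hv : v ∈ Ioi (0 : ℝ)
      · simp only [hg, indicator_of_mem hv, smul_eq_mul]
        rw [← mul_assoc, ← Complex.exp_add, ← mul_sub]
        congr 2
        rw [hs]
        push_cast
        ring
      · simp [hg, indicator_of_notMem hv]
    simp_rw [e]
    rw [integral_indicator measurableSet_Ioi, integral_sub (hL₁ s (by rwa [hsre])).1
      (hL₂ s (by rwa [hsre])).1]
    have e₁ := (hL₁ s (by rwa [hsre])).2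
    have e₂ := (hL₂ s (by rwa [hsre])).2
    rw [laplace] at e₁ e₂
    rw [e₁, e₂, sub_self]
    rfl
  have hgc : ContinuousAt g x := by
    have hnhds : Ioi (0 : ℝ) ∈ 𝓝 x := Ioi_mem_nhds hx
    have : ContinuousAt (fun t : ℝ => Complex.exp (-(σ * t)) * (h₁ t - h₂ t)) x := by
      refine ContinuousAt.mul (by fun_prop) ?_
      exact (hc₁.continuousAt hnhds).sub (hc₂.continuousAt hnhds)
    refine this.congr ?_
    filter_upwards [hnhds] with t ht
    rw [hg, indicator_of_mem ht]
  have hinv := hgint.fourierInv_fourier_eq (by rw [hF]; exact integrable_zero _ _ _) hgc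
  rw [hF, Real.fourierInv_eq] at hinv
  simp only [Pi.zero_apply, smul_zero, integral_zero] at hinv
  rw [hg, indicator_of_mem (show x ∈ Ioi (0 : ℝ) from hx)] at hinv
  exact sub_eq_zero.1 ((mul_eq_zero.1 hinv.symm).resolve_left (Complex.exp_ne_zero _))

theorem IsLaplaceOriginal.invLaplace_eq {G : ℂ → ℂ} {h : ℝ → ℂ} (H : IsLaplaceOriginal G h)
    {x : ℝ} (hx : 0 < x) : invLaplace G x = h x := by
  have hex : ∃ h : ℝ → ℂ, IsLaplaceOriginal G h := ⟨h, H⟩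
  rw [invLaplace, dif_pos hex]
  exact hex.choose_spec.eqOn H hx

/-! ### The effective channel -/

theorem state_congr (Θ : ℝ) {x y : ℕ → ℝ} {k : ℕ} (h : ∀ i < k, x i = y i) :
    state Θ x k = state Θ y k := by
  induction k with
  | zero => rfl
  | succ k ih =>
    simp only [state]
    rw [ih fun i hi => h i (hi.trans k.lt_succ_self), h k k.lt_succ_self]

theorem measurable_state (Θ : ℝ) (k : ℕ) : Measurable fun x : ℕ → ℝ => state Θ x k := by
  induction k with
  | zero => exact measurable_const
  | succ k ih =>
    have h1 := measurable_fst.comp ih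
    have h2 : Measurable fun x : ℕ → ℝ => (state Θ x k).2 + x k :=
      (measurable_snd.comp ih).add (measurable_pi_apply k)
    simp only [state]
    refine Measurable.ite (measurableSet_le measurable_const h2) ?_ ?_
    · exact (h1.add_const 1).prodMk measurable_const
    · exact h1.prodMk h2

namespace IsEffectiveChannel

variable {Ω : Type*} [MeasurableSpace Ω] {P : Measure Ω} {f : ℝ → ℝ}
  {z : ℕ → Ω → ℝ}

theorem measurable_sum (hz : IsEffectiveChannel P f z) (m : ℕ) :
    Measurable fun ω => ∑ i ∈ Finset.range m, z i ω :=
  Finset.measurable_sum _ fun i _ => hz.measurable i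

theorem map_eq (hz : IsEffectiveChannel P f z) (k : ℕ) : P.map (z k) = P.map (z 0) :=
  (hz.law k).trans (hz.law 0).symm

theorem map_absolutelyContinuous (hz : IsEffectiveChannel P f z) (k : ℕ) :
    P.map (z k) ≪ volume := by
  rw [hz.law]
  exact withDensity_absolutelyContinuous _ _

theorem ae_pos (hz : IsEffectiveChannel P f z) (hf : IsChannelPdf f) :
    ∀ᵐ ω ∂P, ∀ i, 0 < z i ω := by
  refine ae_all_iff.2 fun i => ?_
  refine ae_of_ae_map (p := fun t => 0 < t) (hz.measurable i).aemeasurable ?_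
  have h0 : ∀ᵐ t ∂P.map (z i), t ≠ 0 :=
    (hz.map_absolutelyContinuous i).ae_le (Measure.ae_ne volume 0)
  have h1 : ∀ᵐ t ∂P.map (z i), ¬ t < 0 := by
    rw [hz.law, ae_withDensity_iff (hf.measurable.ennreal_ofReal)]
    refine Eventually.of_forall fun t ht hlt => ht ?_
    rw [hf.eq_zero_of_neg t hlt, ENNReal.ofReal_zero]
  filter_upwards [h0, h1] with t ht0 ht1
  exact lt_of_le_of_ne (not_lt.1 ht1) ht0.symm

theorem ae_sum_le_sum_succ (hz : IsEffectiveChannel P f z) (hf : IsChannelPdf f) (m : ℕ) :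
    ∀ᵐ ω ∂P, ∑ i ∈ Finset.range m, z i ω ≤ ∑ i ∈ Finset.range (m + 1), z i ω := by
  filter_upwards [hz.ae_pos hf] with ω hω
  rw [Finset.sum_range_succ]
  exact le_add_of_nonneg_right (hω m).le

/-- A function of the first `k` coordinates factors through the finite tuple padded with zeros, so
independence of finite blocks applies. -/
theorem indepFun_of_past (hz : IsEffectiveChannel P f z) {β : Type*} [MeasurableSpace β] {k : ℕ}
    {Φ : (ℕ → ℝ) → β} (hΦ : Measurable Φ)
    (hcongr : ∀ x y : ℕ → ℝ, (∀ i < k, x i = y i) → Φ x = Φ y) :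
    IndepFun (fun ω => Φ fun i => z i ω) (z k) P := by
  have hind := hz.indep.indepFun_finset (Finset.range k) {k} (by simp) hz.measurable
  let extendZero : (Finset.range k → ℝ) → ℕ → ℝ := fun y i =>
    if h : i ∈ Finset.range k then y ⟨i, h⟩ else 0
  have hext : Measurable extendZero := by
    refine measurable_pi_iff.2 fun i => ?_
    by_cases h : i ∈ Finset.range k
    · simp only [extendZero, dif_pos h]
      exact measurable_pi_apply _
    · simp only [extendZero, dif_neg h]
      exact measurable_const
  have := hind.comp (hΦ.comp hext)
    (measurable_pi_apply (⟨k, Finset.mem_singleton_self k⟩ : ({k} : Finset ℕ)))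
  refine this.congr (Eventually.of_forall fun ω => hcongr _ _ fun i hi => ?_)
    (Eventually.of_forall fun ω => rfl)
  simp [extendZero, hi]

theorem indepFun_state (hz : IsEffectiveChannel P f z) (Θ : ℝ) (k : ℕ) :
    IndepFun (fun ω => state Θ (fun i => z i ω) k) (z k) P :=
  hz.indepFun_of_past (measurable_state Θ k) fun _ _ h => state_congr Θ h

theorem indepFun_sum (hz : IsEffectiveChannel P f z) (k : ℕ) :
    IndepFun (fun ω => ∑ i ∈ Finset.range k, z i ω) (z k) P :=
  hz.indepFun_of_past (Φ := fun x => ∑ i ∈ Finset.range k, x i)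
    (Finset.measurable_sum _ fun i _ => measurable_pi_apply i)
    fun _ _ h => Finset.sum_congr rfl fun i hi => h i (Finset.mem_range.1 hi)

variable [IsProbabilityMeasure P]

theorem lintegral_indep (hz : IsEffectiveChannel P f z) {β : Type*} [MeasurableSpace β] {k : ℕ}
    {X : Ω → β} (hX : Measurable X) (hind : IndepFun X (z k) P) {ψ : β × ℝ → ENNReal}
    (hψ : Measurable ψ) :
    ∫⁻ ω, ψ (X ω, z k ω) ∂P = ∫⁻ ω, ∫⁻ t, ψ (X ω, t) ∂P.map (z 0) ∂P := by
  have hk := hz.measurable k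
  have : IsProbabilityMeasure (P.map (z 0)) :=
    Measure.isProbabilityMeasure_map (hz.measurable 0).aemeasurable
  rw [← lintegral_map hψ (hX.prodMk hk),
    hind.map_prod_eq_prod_map_map hX.aemeasurable hk.aemeasurable, hz.map_eq k,
    lintegral_prod _ hψ.aemeasurable, lintegral_map hψ.lintegral_prod_right' hX]

/-- The partial sums have no atoms in `(0, ∞)`. -/
theorem ae_sum_ne (hz : IsEffectiveChannel P f z) (k : ℕ) {x : ℝ} (hx : 0 < x) :
    ∀ᵐ ω ∂P, ∑ i ∈ Finset.range k, z i ω ≠ x := by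
  cases k with
  | zero => exact Eventually.of_forall fun _ => by simpa using hx.ne
  | succ k =>
    have hms : MeasurableSet {p : ℝ × ℝ | p.1 + p.2 = x} :=
      measurableSet_eq_fun (measurable_fst.add measurable_snd) measurable_const
    have hmi : Measurable ({p : ℝ × ℝ | p.1 + p.2 = x}.indicator (1 : ℝ × ℝ → ENNReal)) :=
      measurable_one.indicator hms
    have h := hz.lintegral_indep (hz.measurable_sum k) (hz.indepFun_sum k)
      hmi
    -- Given the earlier sum `a`, the last channel would have to equal `x - a`, a null event for a
    -- law with a density.
    have h0 : ∀ a : ℝ, ∫⁻ t, {p : ℝ × ℝ | p.1 + p.2 = x}.indicator (1 : ℝ × ℝ → ENNReal) (a, t)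
        ∂P.map (z 0) = 0 := by
      intro a
      refine (lintegral_eq_zero_iff (hmi.comp measurable_prodMk_left)).2 ?_
      filter_upwards [(hz.map_absolutelyContinuous 0).ae_le (Measure.ae_ne volume (x - a))]
        with t ht
      refine indicator_of_notMem (fun hmem => ht ?_) _
      have : a + t = x := hmem
      linarith
    simp_rw [h0, lintegral_zero] at h
    filter_upwards [(lintegral_eq_zero_iff
      (hmi.comp ((hz.measurable_sum k).prodMk (hz.measurable k)))).1 h] with ω hω hsum
    rw [Finset.sum_range_succ] at hsum
    have : (∑ i ∈ Finset.range k, z i ω, z k ω) ∈ {p : ℝ × ℝ | p.1 + p.2 = x} := hsum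
    rw [Function.comp_apply, indicator_of_mem this] at hω
    exact one_ne_zero hω

/-! ### Decoding probabilities -/

theorem Q_antitone (hz : IsEffectiveChannel P f z) (hf : IsChannelPdf f) (x : ℝ) :
    Antitone (Q P z x) := by
  refine antitone_nat_of_succ_le fun m => ?_
  refine ENNReal.toReal_mono (measure_ne_top _ _) (measure_mono_ae ?_)
  filter_upwards [hz.ae_sum_le_sum_succ hf m] with ω hω hlt
  exact lt_of_le_of_lt hω hlt

theorem Q_zero {x : ℝ} (hx : 0 < x) : Q P z x 0 = 1 := by
  simp [Q, hx]

theorem integrable_exp_sum (hz : IsEffectiveChannel P f z) (hf : IsChannelPdf f) {σ : ℝ}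
    (hσ : 0 ≤ σ) (m : ℕ) :
    Integrable (fun ω => Real.exp (-σ * (∑ i ∈ Finset.range m, z i ω))) P := by
  refine Integrable.of_bound
    ((hz.measurable_sum m).const_mul (-σ)).exp.aestronglyMeasurable 1 ?_
  filter_upwards [hz.ae_pos hf] with ω hω
  rw [Real.norm_of_nonneg (Real.exp_pos _).le, Real.exp_le_one_iff]
  have := Finset.sum_nonneg fun i (_ : i ∈ Finset.range m) => (hω i).le
  nlinarith

/-- Chernoff's bound for the probability of an unfinished transmission. -/
theorem Q_le (hz : IsEffectiveChannel P f z) (hf : IsChannelPdf f) {σ : ℝ} (hσ : 0 ≤ σ) (x : ℝ)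
    (m : ℕ) : Q P z x m ≤ Real.exp (σ * x) * mgf (z 0) P (-σ) ^ m := by
  have hfun : (∑ i ∈ Finset.range m, z i) = fun ω => ∑ i ∈ Finset.range m, z i ω := by
    funext ω
    rw [Finset.sum_apply]
  have hmgf : mgf (∑ i ∈ Finset.range m, z i) P (-σ) = mgf (z 0) P (-σ) ^ m := by
    rw [hz.indep.mgf_sum hz.measurable, Finset.prod_congr rfl (g := fun _ => mgf (z 0) P (-σ)),
      Finset.prod_const, Finset.card_range]
    intro i _
    have hm : Measurable fun t : ℝ => Real.exp (-σ * t) := by fun_prop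
    rw [mgf, mgf, ← integral_map (f := fun t => Real.exp (-σ * t)) (hz.measurable i).aemeasurable
      hm.aestronglyMeasurable, hz.map_eq i,
      integral_map (hz.measurable 0).aemeasurable hm.aestronglyMeasurable]
  calc Q P z x m ≤ P.real {ω | (∑ i ∈ Finset.range m, z i) ω ≤ x} := by
        refine measureReal_mono fun ω hω => ?_
        have h : ∑ i ∈ Finset.range m, z i ω < x := hω
        simpa [hfun] using h.le
    _ ≤ Real.exp (-(-σ) * x) * mgf (∑ i ∈ Finset.range m, z i) P (-σ) := by
        refine measure_le_le_exp_mul_mgf x (neg_nonpos.2 hσ) ?_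
        rw [hfun]
        exact hz.integrable_exp_sum hf hσ m
    _ = _ := by rw [hmgf, neg_neg]

/-- The channel is almost surely strictly positive, so `e^{-σ z}` tends to 0 boundedly. Hence
Chernoff's bound beats every geometric rate. -/
theorem tendsto_mgf_neg (hz : IsEffectiveChannel P f z) (hf : IsChannelPdf f) :
    Tendsto (fun σ => mgf (z 0) P (-σ)) atTop (𝓝 0) := by
  have h := tendsto_integral_filter_of_dominated_convergence (μ := P) (l := atTop)
    (F := fun σ ω => Real.exp (-σ * z 0 ω)) (f := fun _ => 0) (fun _ => 1)
    (Eventually.of_forall fun σ => ((hz.measurable 0).const_mul (-σ)).exp.aestronglyMeasurable)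
    ?_ (integrable_const 1) ?_
  · simpa [mgf] using h
  · filter_upwards [eventually_ge_atTop 0] with σ hσ
    filter_upwards [hz.ae_pos hf] with ω hω
    rw [Real.norm_of_nonneg (Real.exp_pos _).le, Real.exp_le_one_iff]
    nlinarith [hω 0]
  · filter_upwards [hz.ae_pos hf] with ω hω
    refine Real.tendsto_exp_atBot.comp ?_
    exact tendsto_neg_atTop_atBot.atBot_mul_const (hω 0)

theorem exists_mgf_lt (hz : IsEffectiveChannel P f z) (hf : IsChannelPdf f) {ε : ℝ}
    (hε : 0 < ε) : ∃ σ, 0 < σ ∧ mgf (z 0) P (-σ) < ε :=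
  ((eventually_gt_atTop 0).and ((hz.tendsto_mgf_neg hf).eventually (gt_mem_nhds hε))).exists

theorem isSurvival_Q (hz : IsEffectiveChannel P f z) (hf : IsChannelPdf f) {x : ℝ}
    (hx : 0 < x) : IsSurvival (Q P z x) where
  nonneg _ := measureReal_nonneg
  antitone := hz.Q_antitone hf x
  zero := Q_zero hx
  summable y hy := by
    obtain ⟨σ, hσ, hlt⟩ := hz.exists_mgf_lt hf (ε := (y + 1)⁻¹) (by positivity)
    have hnn : 0 ≤ mgf (z 0) P (-σ) := mgf_nonneg
    have hlt1 : mgf (z 0) P (-σ) * y < 1 := by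
      calc _ ≤ (y + 1)⁻¹ * y := mul_le_mul_of_nonneg_right hlt.le hy
        _ < 1 := by
          rw [inv_mul_lt_iff₀ (by positivity)]
          linarith
    refine Summable.of_nonneg_of_le (fun m => mul_nonneg measureReal_nonneg (pow_nonneg hy m))
      (fun m => ?_) ((summable_geometric_of_lt_one (mul_nonneg hnn hy) hlt1).mul_left
        (Real.exp (σ * x)))
    calc _ ≤ Real.exp (σ * x) * mgf (z 0) P (-σ) ^ m * y ^ m :=
          mul_le_mul_of_nonneg_right (hz.Q_le hf hσ.le x m) (pow_nonneg hy m)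
      _ = _ := by rw [mul_pow]; ring

theorem measure_decode (hz : IsEffectiveChannel P f z) (hf : IsChannelPdf f) (Θ : ℝ) (m : ℕ) :
    P {ω | ∑ i ∈ Finset.range m, z i ω < Θ ∧ Θ ≤ ∑ i ∈ Finset.range (m + 1), z i ω} =
      ENNReal.ofReal (Q P z Θ m - Q P z Θ (m + 1)) := by
  have hms : ∀ m, MeasurableSet {ω | ∑ i ∈ Finset.range m, z i ω < Θ} := fun m =>
    measurableSet_lt (hz.measurable_sum m) measurable_const
  have hsub : {ω | ∑ i ∈ Finset.range (m + 1), z i ω < Θ} ≤ᵐ[P]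
      {ω | ∑ i ∈ Finset.range m, z i ω < Θ} := by
    filter_upwards [hz.ae_sum_le_sum_succ hf m] with ω hω hlt
    exact lt_of_le_of_lt hω hlt
  have hset : {ω | ∑ i ∈ Finset.range m, z i ω < Θ ∧ Θ ≤ ∑ i ∈ Finset.range (m + 1), z i ω} =
      {ω | ∑ i ∈ Finset.range m, z i ω < Θ} \ {ω | ∑ i ∈ Finset.range (m + 1), z i ω < Θ} := by
    ext ω
    simp
  have hinter : P ({ω | ∑ i ∈ Finset.range m, z i ω < Θ} ∩
      {ω | ∑ i ∈ Finset.range (m + 1), z i ω < Θ}) =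
      P {ω | ∑ i ∈ Finset.range (m + 1), z i ω < Θ} := by
    refine measure_congr (inter_subset_right.eventuallyLE.antisymm ?_)
    filter_upwards [hsub] with ω hω hlt
    exact ⟨hω hlt, hlt⟩
  rw [hset, Q, Q, ENNReal.ofReal_sub _ measureReal_nonneg, ofReal_measureReal,
    ofReal_measureReal]
  refine ENNReal.eq_sub_of_add_eq (measure_ne_top _ _) ?_
  rw [← hinter]
  exact measure_sdiff_add_inter _ (hms (m + 1))

end IsEffectiveChannel

namespace IsEffectiveChannel

variable {Ω : Type*} [MeasurableSpace Ω] {P : Measure Ω} {f : ℝ → ℝ} {z : ℕ → Ω → ℝ}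

/-! ### The service process -/

theorem measurable_state_comp (hz : IsEffectiveChannel P f z) (Θ : ℝ) (k : ℕ) :
    Measurable fun ω => state Θ (fun i => z i ω) k :=
  (measurable_state Θ k).comp (measurable_pi_iff.2 hz.measurable)

variable [IsProbabilityMeasure P]

/-- One more transmission of a packet that is not yet decoded after `m` transmissions. -/
theorem lintegral_transmission (hz : IsEffectiveChannel P f z) (hf : IsChannelPdf f) (Θ : ℝ)
    {β : ENNReal} {φ : ℝ → ENNReal} (hφ : Measurable φ) (m : ℕ) :
    ∫⁻ ω, (Iio Θ).indicator
        (fun a => ∫⁻ t, (if Θ ≤ a + t then β * φ 0 else φ (a + t)) ∂P.map (z 0))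
        (∑ i ∈ Finset.range m, z i ω) ∂P =
      β * φ 0 * ENNReal.ofReal (Q P z Θ m - Q P z Θ (m + 1)) +
        ∫⁻ ω, (Iio Θ).indicator φ (∑ i ∈ Finset.range (m + 1), z i ω) ∂P := by
  have hadd : Measurable fun p : ℝ × ℝ => p.1 + p.2 := measurable_fst.add measurable_snd
  have hψ : Measurable fun p : ℝ × ℝ =>
      (Iio Θ).indicator (fun a => if Θ ≤ a + p.2 then β * φ 0 else φ (a + p.2)) p.1 := by
    have : (fun p : ℝ × ℝ =>
        (Iio Θ).indicator (fun a => if Θ ≤ a + p.2 then β * φ 0 else φ (a + p.2)) p.1) =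
        {p : ℝ × ℝ | p.1 < Θ}.indicator
          fun p => if Θ ≤ p.1 + p.2 then β * φ 0 else φ (p.1 + p.2) := by
      funext p
      by_cases hp : p.1 < Θ <;> simp [indicator, hp]
    rw [this]
    exact (Measurable.ite (measurableSet_le measurable_const hadd) measurable_const
      (hφ.comp hadd)).indicator (measurableSet_lt measurable_fst measurable_const)
  have hms : MeasurableSet {ω | ∑ i ∈ Finset.range m, z i ω < Θ ∧
      Θ ≤ ∑ i ∈ Finset.range (m + 1), z i ω} :=
    (measurableSet_lt (hz.measurable_sum m) measurable_const).inter
      (measurableSet_le measurable_const (hz.measurable_sum (m + 1)))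
  calc _ = ∫⁻ ω, ∫⁻ t, (Iio Θ).indicator (fun a => if Θ ≤ a + t then β * φ 0 else φ (a + t))
        (∑ i ∈ Finset.range m, z i ω) ∂P.map (z 0) ∂P := by
        refine lintegral_congr fun ω => ?_
        by_cases h : ∑ i ∈ Finset.range m, z i ω ∈ Iio Θ
        · simp_rw [indicator_of_mem h]
        · simp_rw [indicator_of_notMem h, lintegral_zero]
    _ = ∫⁻ ω, (Iio Θ).indicator (fun a => if Θ ≤ a + z m ω then β * φ 0 else φ (a + z m ω))
        (∑ i ∈ Finset.range m, z i ω) ∂P :=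
        (hz.lintegral_indep (hz.measurable_sum m) (hz.indepFun_sum m) hψ).symm
    -- Either the new slot decodes the packet, which resets the accumulated sum to 0 and costs a
    -- factor `β`, or the sum stays below `Θ`.
    _ = ∫⁻ ω, (β * φ 0 * {ω | ∑ i ∈ Finset.range m, z i ω < Θ ∧
          Θ ≤ ∑ i ∈ Finset.range (m + 1), z i ω}.indicator 1 ω +
        (Iio Θ).indicator φ (∑ i ∈ Finset.range (m + 1), z i ω)) ∂P := by
        refine lintegral_congr_ae ?_
        filter_upwards [hz.ae_sum_le_sum_succ hf m] with ω hω
        have hsucc := Finset.sum_range_succ (fun i => z i ω) m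
        by_cases h1 : ∑ i ∈ Finset.range m, z i ω < Θ
        · rw [indicator_of_mem (show _ ∈ Iio Θ from h1), ← hsucc]
          by_cases h2 : Θ ≤ ∑ i ∈ Finset.range (m + 1), z i ω
          · simp [indicator, h1, h2, not_lt.2 h2]
          · simp [indicator, h2, not_le.1 h2]
        · have h2 : ¬ ∑ i ∈ Finset.range (m + 1), z i ω < Θ := fun h => h1 (hω.trans_lt h)
          simp [indicator, h1, h2]
    _ = _ := by
        rw [lintegral_add_left ((measurable_one.indicator hms).const_mul _),
          lintegral_const_mul _ (measurable_one.indicator hms), lintegral_indicator_one hms,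
          hz.measure_decode hf]

/-- The law of the accumulated effective channel, weighted with `b ^ N_k` and decomposed according
to the slot in which the current packet was started. -/
theorem lintegral_state (hz : IsEffectiveChannel P f z) (hf : IsChannelPdf f) {Θ b : ℝ}
    (hΘ : 0 < Θ) (hb : 0 < b) (k : ℕ) {φ : ℝ → ENNReal} (hφ : Measurable φ) :
    ∫⁻ ω, ENNReal.ofReal b ^ (state Θ (fun i => z i ω) k).1 *
        φ (state Θ (fun i => z i ω) k).2 ∂P =
      ∑ j ∈ Finset.range (k + 1),
        ENNReal.ofReal (renewalSeq (fun m => b * (Q P z Θ m - Q P z Θ (m + 1))) j) *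
          ∫⁻ ω, (Iio Θ).indicator φ (∑ i ∈ Finset.range (k - j), z i ω) ∂P := by
  have hq := hz.isSurvival_Q hf hΘ
  set p : ℕ → ℝ := fun m => b * (Q P z Θ m - Q P z Θ (m + 1)) with hp
  have hp0 : ∀ m, 0 ≤ p m := fun m => mul_nonneg hb.le (hq.sub_nonneg m)
  set β := ENNReal.ofReal b with hβ
  have hnil : ∫⁻ ω, (Iio Θ).indicator φ (∑ i ∈ Finset.range 0, z i ω) ∂P = φ 0 := by
    simp [hΘ]
  -- The test function must vary: averaging over the newest slot turns `φ` into another test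
  -- function of the previous state.
  induction k generalizing φ with
  | zero =>
    rw [Finset.sum_range_one, Nat.sub_zero, hnil, renewalSeq_zero]
    simp [state]
  | succ k ih =>
    have hadd : Measurable fun p : ℝ × ℝ => p.1 + p.2 := measurable_fst.add measurable_snd
    have hψ : Measurable fun p : ℝ × ℝ =>
        if Θ ≤ p.1 + p.2 then β * φ 0 else φ (p.1 + p.2) :=
      Measurable.ite (measurableSet_le measurable_const hadd) measurable_const (hφ.comp hadd)
    have hpow : Measurable fun p : (ℕ × ℝ) × ℝ => β ^ p.1.1 :=
      (measurable_of_countable fun n : ℕ => β ^ n).comp (measurable_fst.comp measurable_fst)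
    have hψ' : Measurable fun p : (ℕ × ℝ) × ℝ =>
        β ^ p.1.1 * if Θ ≤ p.1.2 + p.2 then β * φ 0 else φ (p.1.2 + p.2) :=
      hpow.mul (hψ.comp ((measurable_snd.comp measurable_fst).prodMk measurable_snd))
    calc _ = ∫⁻ ω, β ^ (state Θ (fun i => z i ω) k).1 *
          (if Θ ≤ (state Θ (fun i => z i ω) k).2 + z k ω then β * φ 0
            else φ ((state Θ (fun i => z i ω) k).2 + z k ω)) ∂P := by
          refine lintegral_congr fun ω => ?_
          simp only [state]
          split_ifs
          · rw [pow_succ, mul_assoc]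
          · rfl
      _ = ∫⁻ ω, β ^ (state Θ (fun i => z i ω) k).1 *
          ∫⁻ t, (if Θ ≤ (state Θ (fun i => z i ω) k).2 + t then β * φ 0
            else φ ((state Θ (fun i => z i ω) k).2 + t)) ∂P.map (z 0) ∂P := by
          rw [hz.lintegral_indep (hz.measurable_state_comp Θ k) (hz.indepFun_state Θ k) hψ']
          refine lintegral_congr fun ω => ?_
          exact lintegral_const_mul (β ^ (state Θ (fun i => z i ω) k).1)
            (hψ.comp (measurable_prodMk_left (x := (state Θ (fun i => z i ω) k).2)))
      _ = ∑ j ∈ Finset.range (k + 1), ENNReal.ofReal (renewalSeq p j) *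
          (β * φ 0 * ENNReal.ofReal (Q P z Θ (k - j) - Q P z Θ (k - j + 1)) +
            ∫⁻ ω, (Iio Θ).indicator φ (∑ i ∈ Finset.range (k - j + 1), z i ω) ∂P) := by
          have : IsProbabilityMeasure (P.map (z 0)) :=
            Measure.isProbabilityMeasure_map (hz.measurable 0).aemeasurable
          rw [ih hψ.lintegral_prod_right' (by simp [hΘ])]
          refine Finset.sum_congr rfl fun j _ => ?_
          rw [← hz.lintegral_transmission hf Θ hφ (k - j)]
      -- The decoding terms add up to the renewal recursion and form the new summand `j = k + 1`, a
      -- packet about to start.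
      _ = ENNReal.ofReal (renewalSeq p (k + 1)) * φ 0 +
          ∑ j ∈ Finset.range (k + 1), ENNReal.ofReal (renewalSeq p j) *
            ∫⁻ ω, (Iio Θ).indicator φ (∑ i ∈ Finset.range (k - j + 1), z i ω) ∂P := by
          simp_rw [mul_add]
          rw [Finset.sum_add_distrib, renewalSeq_succ, ENNReal.ofReal_sum_of_nonneg
            fun j _ => mul_nonneg (renewalSeq_nonneg hp0 j) (hp0 _), Finset.sum_mul]
          congr 1
          refine Finset.sum_congr rfl fun j _ => ?_
          rw [ENNReal.ofReal_mul (renewalSeq_nonneg hp0 j), hp, ENNReal.ofReal_mul hb.le]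
          ring
      _ = _ := by
          rw [Finset.sum_range_succ _ (k + 1), Nat.sub_self, hnil, add_comm]
          congr 1
          refine Finset.sum_congr rfl fun j hj => ?_
          rw [Nat.sub_add_comm (Nat.lt_succ_iff.1 (Finset.mem_range.1 hj))]

theorem integrable_exp_numDecoded (hz : IsEffectiveChannel P f z) (Θ : ℝ) {c : ℝ} (hc : 0 ≤ c)
    (k : ℕ) : Integrable (fun ω => Real.exp (-(c * numDecoded z Θ k ω))) P := by
  have hm : Measurable fun ω => Real.exp (-(c * numDecoded z Θ k ω)) :=
    (measurable_of_countable fun n : ℕ => Real.exp (-(c * n))).comp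
      (measurable_fst.comp (hz.measurable_state_comp Θ k))
  refine Integrable.of_bound hm.aestronglyMeasurable 1 (Eventually.of_forall fun ω => ?_)
  rw [Real.norm_of_nonneg (Real.exp_pos _).le, Real.exp_le_one_iff]
  have : 0 ≤ c * (numDecoded z Θ k ω : ℝ) := by positivity
  linarith

theorem integral_exp_numDecoded (hz : IsEffectiveChannel P f z) (hf : IsChannelPdf f) {Θ c : ℝ}
    (hΘ : 0 < Θ) (hc : 0 ≤ c) (k : ℕ) :
    ∫ ω, Real.exp (-(c * numDecoded z Θ k ω)) ∂P =
      ∑ j ∈ Finset.range (k + 1),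
        renewalSeq (fun m => Real.exp (-c) * (Q P z Θ m - Q P z Θ (m + 1))) j *
          Q P z Θ (k - j) := by
  have hq := hz.isSurvival_Q hf hΘ
  have hr := renewalSeq_nonneg (p := fun m => Real.exp (-c) * (Q P z Θ m - Q P z Θ (m + 1)))
    fun m => mul_nonneg (Real.exp_pos _).le (hq.sub_nonneg m)
  have h := hz.lintegral_state hf hΘ (Real.exp_pos (-c)) k (φ := 1) measurable_one
  rw [integral_eq_lintegral_of_nonneg_ae (Eventually.of_forall fun ω => (Real.exp_pos _).le)
    (hz.integrable_exp_numDecoded Θ hc k).aestronglyMeasurable]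
  have e : ∀ ω, ENNReal.ofReal (Real.exp (-(c * numDecoded z Θ k ω))) =
      ENNReal.ofReal (Real.exp (-c)) ^ (state Θ (fun i => z i ω) k).1 *
        (1 : ℝ → ENNReal) (state Θ (fun i => z i ω) k).2 := by
    intro ω
    rw [Pi.one_apply, mul_one, ← ENNReal.ofReal_pow (Real.exp_pos _).le, ← Real.exp_nat_mul,
      numDecoded]
    congr 2
    ring
  simp_rw [e]
  rw [h, ENNReal.toReal_sum]
  · refine Finset.sum_congr rfl fun j _ => ?_
    rw [ENNReal.toReal_mul, ENNReal.toReal_ofReal (hr j)]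
    congr 1
    have hms : MeasurableSet {ω | ∑ i ∈ Finset.range (k - j), z i ω < Θ} :=
      measurableSet_lt (hz.measurable_sum _) measurable_const
    rw [Q, measureReal_def, ← lintegral_indicator_one hms]
    rfl
  · intro j _
    refine ENNReal.mul_ne_top ENNReal.ofReal_ne_top (ne_top_of_le_ne_top ENNReal.one_ne_top ?_)
    calc _ ≤ ∫⁻ _, 1 ∂P := lintegral_mono fun ω =>
          indicator_le (g := fun _ => 1) (fun _ _ => le_rfl) _
      _ = 1 := by simp

theorem tendsto_effCapacity (hz : IsEffectiveChannel P f z) (hf : IsChannelPdf f)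
    {Θ θ R lam : ℝ} (hΘ : 0 < Θ) (hθ : 0 < θ) (hR : 0 < R) (hlam : 0 < lam)
    (h : lifeGen (Q P z Θ) lam⁻¹ = (Real.exp (-(θ * R)))⁻¹) :
    Tendsto (fun k => effCapacity P z Θ θ R k) atTop (𝓝 (-(Real.log lam) / θ)) := by
  have hc : 0 ≤ θ * R := by positivity
  have ht := (hz.isSurvival_Q hf hΘ).tendsto_log_div hlam (Real.exp_pos _) h
    (hz.integral_exp_numDecoded hf hΘ hc)
    fun k => integral_exp_pos (hz.integrable_exp_numDecoded Θ hc k)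
  refine (ht.neg.div_const θ).congr fun k => ?_
  -- The identity also covers `k = 0`, where both sides are 0 because division by zero gives 0.
  rw [effCapacity, one_div, mul_inv]
  ring

end IsEffectiveChannel

namespace IsEffectiveChannel

variable {Ω : Type*} [MeasurableSpace Ω] {P : Measure Ω} {f : ℝ → ℝ} {z : ℕ → Ω → ℝ}

/-! ### Laplace transforms of the decoding probabilities -/

theorem laplace_pdf (hz : IsEffectiveChannel P f z) (hf : IsChannelPdf f) (s : ℂ) (i : ℕ) :
    ∫ ω, Complex.exp (-(s * z i ω)) ∂P = laplace (fun t => (f t : ℂ)) s := by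
  have hm : Measurable fun t : ℝ => Complex.exp (-(s * t)) := by fun_prop
  rw [← integral_map (f := fun t : ℝ => Complex.exp (-(s * t))) (hz.measurable i).aemeasurable
    hm.aestronglyMeasurable, hz.law, integral_withDensity_eq_integral_toReal_smul
      hf.measurable.ennreal_ofReal (Eventually.of_forall fun _ => ENNReal.ofReal_lt_top),
    laplace, ← integral_Ici_eq_integral_Ioi, setIntegral_eq_integral_of_forall_compl_eq_zero]
  · refine integral_congr_ae (Eventually.of_forall fun t => ?_)
    simp only [ENNReal.toReal_ofReal (hf.nonneg t), Complex.real_smul]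
    ring
  · intro t ht
    rw [hf.eq_zero_of_neg t (by simpa using ht)]
    simp

theorem norm_exp_neg_mul (s : ℂ) (t : ℝ) :
    ‖Complex.exp (-(s * t))‖ = Real.exp (-(s.re * t)) := by
  rw [Complex.norm_exp]
  simp

theorem integral_exp_sum (hz : IsEffectiveChannel P f z) (hf : IsChannelPdf f) (s : ℂ) (k : ℕ) :
    ∫ ω, Complex.exp (-(s * (∑ i ∈ Finset.range k, z i ω : ℝ))) ∂P =
      laplace (fun t => (f t : ℂ)) s ^ k := by
  have hm : Measurable fun t : ℝ => Complex.exp (-(s * t)) := by fun_prop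
  have h := (hz.indep.precomp (Fin.val_injective (n := k))).integral_fun_prod_comp
    (f := fun _ (t : ℝ) => Complex.exp (-(s * t))) (fun i => (hz.measurable i).aemeasurable)
    fun _ => hm.aestronglyMeasurable
  simp only [hz.laplace_pdf hf] at h
  rw [Finset.prod_const, Finset.card_univ, Fintype.card_fin] at h
  rw [← h]
  congr 1
  funext ω
  rw [← Complex.exp_sum, Fin.sum_univ_eq_sum_range (fun i => -(s * (z i ω : ℂ))),
    Finset.sum_neg_distrib, ← Finset.mul_sum]
  push_cast
  rfl

variable [IsProbabilityMeasure P]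

theorem norm_laplace_pdf_le (hz : IsEffectiveChannel P f z) (hf : IsChannelPdf f) {c : ℝ}
    (hc : 0 ≤ c) {s : ℂ} (hs : c ≤ s.re) :
    ‖laplace (fun t => (f t : ℂ)) s‖ ≤ mgf (z 0) P (-c) := by
  rw [← hz.laplace_pdf hf s 0]
  refine norm_integral_le_of_norm_le ?_ ?_
  · simpa using hz.integrable_exp_sum hf hc 1
  · filter_upwards [hz.ae_pos hf] with ω hω
    rw [norm_exp_neg_mul, Real.exp_le_exp]
    nlinarith [hω 0]

theorem monotone_Q (P : Measure Ω) [IsProbabilityMeasure P] (z : ℕ → Ω → ℝ) (k : ℕ) :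
    Monotone fun t => Q P z t k := fun _ _ hst =>
  measureReal_mono fun _ hω => lt_of_lt_of_le hω hst

theorem integrableOn_exp_mul_Q {s : ℂ} (hs : 0 < s.re) (k : ℕ) :
    IntegrableOn (fun t : ℝ => Complex.exp (-(s * t)) * (Q P z t k : ℂ)) (Ioi 0) := by
  have hm : Measurable fun t : ℝ => Complex.exp (-(s * t)) := by fun_prop
  refine Integrable.mono' (exp_neg_integrableOn_Ioi 0 hs)
    (hm.mul (Complex.measurable_ofReal.comp
      (monotone_Q P z k).measurable)).aestronglyMeasurable (Eventually.of_forall fun t => ?_)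
  rw [norm_mul, norm_exp_neg_mul, Complex.norm_real, Q,
    Real.norm_of_nonneg measureReal_nonneg, neg_mul]
  exact mul_le_of_le_one_right (Real.exp_pos _).le measureReal_le_one

/-- By Fubini, `∫ e^{-st} 1{S < t} dt = e^{-sS} / s` is averaged over `S`; independence turns the
mean of `e^{-sS}` into a power of `F`. -/
theorem laplace_Q (hz : IsEffectiveChannel P f z) (hf : IsChannelPdf f) {s : ℂ}
    (hs : 0 < s.re) (k : ℕ) :
    laplace (fun t => (Q P z t k : ℂ)) s = laplace (fun t => (f t : ℂ)) s ^ k / s := by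
  set S : Ω → ℝ := fun ω => ∑ i ∈ Finset.range k, z i ω with hS
  have hSm : Measurable S := hz.measurable_sum k
  have hQ : ∀ t, (Q P z t k : ℂ) = ∫ ω, {ω | S ω < t}.indicator (fun _ => (1 : ℂ)) ω ∂P := by
    intro t
    rw [integral_indicator (measurableSet_lt hSm measurable_const), setIntegral_const]
    simp [Q, hS]
  have hms : MeasurableSet {p : ℝ × Ω | S p.2 < p.1} :=
    measurableSet_lt (hSm.comp measurable_snd) measurable_fst
  have hint : Integrable (fun p : ℝ × Ω => Complex.exp (-(s * p.1)) *
      {p : ℝ × Ω | S p.2 < p.1}.indicator (fun _ => (1 : ℂ)) p)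
      ((volume.restrict (Ioi 0)).prod P) := by
    have hm : Measurable fun p : ℝ × Ω => Complex.exp (-(s * p.1)) := by fun_prop
    refine Integrable.mono' (Integrable.mul_prod (exp_neg_integrableOn_Ioi 0 hs)
      (integrable_const (1 : ℝ)))
      (hm.mul (measurable_const.indicator hms)).aestronglyMeasurable
      (Eventually.of_forall fun p => ?_)
    rw [norm_mul, norm_exp_neg_mul, neg_mul]
    refine mul_le_mul_of_nonneg_left ?_ (Real.exp_pos _).le
    exact (norm_indicator_le_norm_self _ _).trans (by simp)
  rw [← hz.integral_exp_sum hf s k, laplace, ← integral_div]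
  calc _ = ∫ t in Ioi (0 : ℝ), ∫ ω, Complex.exp (-(s * t)) *
        {p : ℝ × Ω | S p.2 < p.1}.indicator (fun _ => (1 : ℂ)) (t, ω) ∂P := by
        refine integral_congr_ae (Eventually.of_forall fun t => ?_)
        simp only [hQ t]
        rw [← integral_const_mul]
        rfl
    _ = ∫ ω, (∫ t in Ioi (0 : ℝ), Complex.exp (-(s * t)) *
        {p : ℝ × Ω | S p.2 < p.1}.indicator (fun _ => (1 : ℂ)) (t, ω)) ∂P :=
        integral_integral_swap hint
    _ = _ := by
        refine integral_congr_ae ?_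
        filter_upwards [hz.ae_pos hf] with ω hω
        have hS0 : 0 ≤ S ω := Finset.sum_nonneg fun i _ => (hω i).le
        have e : ∀ t : ℝ, Complex.exp (-(s * t)) *
            {p : ℝ × Ω | S p.2 < p.1}.indicator (fun _ => (1 : ℂ)) (t, ω) =
            (Ioi (S ω)).indicator (fun t : ℝ => Complex.exp (-s * t)) t := by
          intro t
          by_cases ht : S ω < t <;> simp [indicator, ht]
        simp_rw [e]
        rw [setIntegral_indicator measurableSet_Ioi, Ioi_inter_Ioi, max_eq_right hS0,
          integral_exp_mul_complex_Ioi (by simpa using hs), neg_div_neg_eq, neg_mul]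

/-! ### The inverse Laplace transform of the kernel -/

/-- Near `x` the indicator of `S < t` is constant in `t` unless `S = x`, which is a null event;
dominated convergence does the rest. -/
theorem continuousAt_Q (hz : IsEffectiveChannel P f z) (k : ℕ) {x : ℝ} (hx : 0 < x) :
    ContinuousAt (fun t => Q P z t k) x := by
  set S : Ω → ℝ := fun ω => ∑ i ∈ Finset.range k, z i ω with hS
  have hms : ∀ t, MeasurableSet {ω | S ω < t} := fun t =>
    measurableSet_lt (hz.measurable_sum k) measurable_const
  have hQ : (fun t => Q P z t k) = fun t => ∫ ω, {ω | S ω < t}.indicator (fun _ => (1 : ℝ)) ω ∂P := by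
    funext t
    rw [integral_indicator (hms t), setIntegral_const]
    simp [Q, hS]
  rw [hQ]
  refine continuousAt_of_dominated (bound := fun _ => 1)
    (Eventually.of_forall fun t => (measurable_const.indicator (hms t)).aestronglyMeasurable)
    (Eventually.of_forall fun t => Eventually.of_forall fun ω =>
      (norm_indicator_le_norm_self _ _).trans (by simp)) (integrable_const 1) ?_
  filter_upwards [hz.ae_sum_ne k hx] with ω hω
  refine (continuousAt_const (y := {ω | S ω < x}.indicator (fun _ => (1 : ℝ)) ω)).congr ?_
  rcases lt_or_gt_of_ne hω with h | h
  · filter_upwards [lt_mem_nhds h] with t ht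
    rw [indicator_of_mem (show ω ∈ {ω | S ω < x} from h),
      indicator_of_mem (show ω ∈ {ω | S ω < t} from ht)]
  · filter_upwards [gt_mem_nhds h] with t ht
    rw [indicator_of_notMem (show ω ∉ {ω | S ω < x} from not_lt.2 (le_of_lt h)),
      indicator_of_notMem (show ω ∉ {ω | S ω < t} from not_lt.2 (le_of_lt ht))]

theorem norm_term_le (hz : IsEffectiveChannel P f z) (hf : IsChannelPdf f) {lam c : ℝ}
    (hlam : 0 < lam) (hc : 0 ≤ c) (t : ℝ) (k : ℕ) :
    ‖(Q P z t k - Q P z t (k + 1)) * lam⁻¹ ^ (k + 1)‖ ≤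
      Real.exp (c * t) * (mgf (z 0) P (-c) ^ k * lam⁻¹ ^ (k + 1)) := by
  have hnn : 0 ≤ Q P z t k - Q P z t (k + 1) := sub_nonneg.2 (hz.Q_antitone hf t k.le_succ)
  have hl : 0 ≤ lam⁻¹ ^ (k + 1) := pow_nonneg (inv_pos.2 hlam).le _
  have hQ1 : 0 ≤ Q P z t (k + 1) := measureReal_nonneg
  rw [Real.norm_of_nonneg (mul_nonneg hnn hl), ← mul_assoc]
  refine mul_le_mul_of_nonneg_right ?_ hl
  linarith [hz.Q_le hf hc t k]

theorem summable_bound {r lam : ℝ} (hr : 0 ≤ r) (hrl : r < lam) :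
    Summable fun k => r ^ k * lam⁻¹ ^ (k + 1) := by
  have hlam : 0 < lam := hr.trans_lt hrl
  refine ((summable_geometric_of_lt_one (div_nonneg hr hlam.le)
    ((div_lt_one hlam).2 hrl)).mul_left lam⁻¹).congr fun k => ?_
  rw [div_pow, pow_succ, inv_pow]
  field_simp

theorem isLaplaceOriginal_kernel (hz : IsEffectiveChannel P f z) (hf : IsChannelPdf f)
    {lam : ℝ} (hlam : 0 < lam) :
    IsLaplaceOriginal (kernel f lam) fun t => (lifeGen (Q P z t) lam⁻¹ : ℂ) := by
  -- This `c` serves twice: Chernoff's bound at `c` dominates the series by `e^{ct}` times a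
  -- convergent geometric series, and `|F(s)| < lam` for `Re s > c`.
  obtain ⟨c, hc, hclt⟩ := hz.exists_mgf_lt hf hlam
  set r := mgf (z 0) P (-c) with hr
  have hr0 : 0 ≤ r := mgf_nonneg
  have hsum := summable_bound hr0 hclt
  have hterm := fun t k => hz.norm_term_le hf hlam hc.le t k
  have hcont : ContinuousOn (fun t => (lifeGen (Q P z t) lam⁻¹ : ℂ)) (Ioi 0) := by
    refine Complex.continuous_ofReal.comp_continuousOn fun x hx => ContinuousAt.continuousWithinAt ?_
    have hnhds : Ioo 0 (x + 1) ∈ 𝓝 x := Ioo_mem_nhds hx (lt_add_one x)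
    refine ContinuousOn.continuousAt (s := Ioo 0 (x + 1)) ?_ hnhds
    refine continuousOn_tsum (u := fun k => Real.exp (c * (x + 1)) * (r ^ k * lam⁻¹ ^ (k + 1)))
      (fun k t ht => ?_) (hsum.mul_left _) fun k t ht => ?_
    · exact (((hz.continuousAt_Q k ht.1).sub (hz.continuousAt_Q (k + 1) ht.1)).mul_const
        _).continuousWithinAt
    · refine (hterm t k).trans (mul_le_mul_of_nonneg_right ?_ ?_)
      · exact Real.exp_le_exp.2 (mul_le_mul_of_nonneg_left ht.2.le hc.le)
      · exact mul_nonneg (pow_nonneg hr0 k) (pow_nonneg (inv_pos.2 hlam).le _)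
  refine ⟨hcont, c, fun s hs => ?_⟩
  have hs0 : 0 < s.re := hc.trans hs
  have hexp : IntegrableOn (fun t => Real.exp (-(s.re - c) * t)) (Ioi 0) :=
    exp_neg_integrableOn_Ioi 0 (sub_pos.2 hs)
  have hm : Measurable fun t : ℝ => Complex.exp (-(s * t)) := by fun_prop
  have hsplit : ∀ t u : ℝ, Real.exp (-(s.re * t)) * (Real.exp (c * t) * u) =
      u * Real.exp (-(s.re - c) * t) := by
    intro t u
    rw [← mul_assoc, ← Real.exp_add, mul_comm]
    congr 2
    ring
  constructor
  · refine Integrable.mono' (hexp.const_mul (∑' k, r ^ k * lam⁻¹ ^ (k + 1)))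
      (hm.aestronglyMeasurable.mul (hcont.aestronglyMeasurable measurableSet_Ioi))
      (Eventually.of_forall fun t => ?_)
    rw [norm_mul, norm_exp_neg_mul, Complex.norm_real, ← hsplit, ← tsum_mul_left]
    refine mul_le_mul_of_nonneg_left ?_ (Real.exp_pos _).le
    exact tsum_of_norm_bounded (hsum.mul_left _).hasSum (hterm t)
  · set F := laplace (fun t => (f t : ℂ)) s with hF
    set G : ℕ → ℝ → ℂ := fun k t => Complex.exp (-(s * t)) *
      (((Q P z t k - Q P z t (k + 1)) * lam⁻¹ ^ (k + 1) : ℝ) : ℂ) with hG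
    have hGint : ∀ k, Integrable (G k) (volume.restrict (Ioi 0)) ∧
        ∫ t in Ioi (0 : ℝ), G k t = (1 / s) * (1 - F) * (lam : ℂ)⁻¹ * (F / lam) ^ k := by
      intro k
      have e : G k = fun t : ℝ => (Complex.exp (-(s * t)) * (Q P z t k : ℂ) -
          Complex.exp (-(s * t)) * (Q P z t (k + 1) : ℂ)) * (lam : ℂ)⁻¹ ^ (k + 1) := by
        funext t
        simp only [hG]
        push_cast
        ring
      have h1 := integrableOn_exp_mul_Q (P := P) (z := z) hs0 k
      have h2 := integrableOn_exp_mul_Q (P := P) (z := z) hs0 (k + 1)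
      have e1 := hz.laplace_Q hf hs0 k
      have e2 := hz.laplace_Q hf hs0 (k + 1)
      rw [laplace] at e1 e2
      rw [e]
      refine ⟨(h1.sub h2).mul_const _, ?_⟩
      rw [integral_mul_const, integral_sub h1 h2, e1, e2, ← hF, div_pow, pow_succ, pow_succ,
        inv_pow]
      ring
    have hFlt : ‖F / lam‖ < 1 := by
      rw [norm_div, Complex.norm_real, Real.norm_of_nonneg hlam.le, div_lt_one hlam]
      exact (hz.norm_laplace_pdf_le hf hc.le hs.le).trans_lt hclt
    have hnorm : Summable fun k => ∫ t in Ioi (0 : ℝ), ‖G k t‖ := by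
      refine Summable.of_nonneg_of_le (fun k => integral_nonneg fun t => norm_nonneg _)
        (fun k => ?_) (hsum.mul_right (∫ t in Ioi (0 : ℝ), Real.exp (-(s.re - c) * t)))
      rw [← integral_const_mul]
      refine integral_mono (hGint k).1.norm (hexp.const_mul _) fun t => ?_
      simp only [hG]
      rw [norm_mul, norm_exp_neg_mul, Complex.norm_real, ← hsplit]
      exact mul_le_mul_of_nonneg_left (hterm t k) (Real.exp_pos _).le
    have hS := hasSum_integral_of_summable_integral_norm (fun k => (hGint k).1) hnorm
    simp_rw [fun k => (hGint k).2] at hS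
    -- Termwise, the transform is `(F^k - F^{k+1}) lam^{-(k+1)} / s`, a geometric series of ratio `F
    -- / lam`.
    have hgeo := (hasSum_geometric_of_norm_lt_one hFlt).mul_left ((1 / s) * (1 - F) * (lam : ℂ)⁻¹)
    have hval := hS.unique hgeo
    have hlamc : (lam : ℂ) ≠ 0 := by exact_mod_cast hlam.ne'
    rw [laplace, kernel, ← hF]
    calc _ = ∫ t in Ioi (0 : ℝ), ∑' k, G k t := by
          refine integral_congr_ae (Eventually.of_forall fun t => ?_)
          simp only [hG, lifeGen]
          rw [tsum_mul_left, Complex.ofReal_tsum]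
      _ = _ := hval
      _ = _ := by
          have hden : (lam : ℂ) * (1 - F / lam) = lam - F := by
            field_simp
          rw [mul_assoc, ← mul_inv, hden]
          ring

theorem invLaplace_kernel (hz : IsEffectiveChannel P f z) (hf : IsChannelPdf f)
    {lam Θ : ℝ} (hlam : 0 < lam) (hΘ : 0 < Θ) :
    invLaplace (kernel f lam) Θ = (lifeGen (Q P z Θ) lam⁻¹ : ℂ) :=
  (hz.isLaplaceOriginal_kernel hf hlam).invLaplace_eq hΘ

end IsEffectiveChannel

theorem companion_eq_rowCompanion {Ω : Type*} [MeasurableSpace Ω] (P : Measure Ω)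
    (z : ℕ → Ω → ℝ) (Θ θ R : ℝ) (M : ℕ) :
    companion P z Θ θ R M =
      rowCompanion (truncRow (Q P z Θ) (Real.exp (-(θ * R))) M) M := by
  ext i j
  simp only [companion, rowCompanion, coeff, truncRow, decodeProb, Matrix.of_apply,
    Nat.add_sub_cancel, mul_comm (Real.exp (-(θ * R)))]

end HARQ
end

theorem theorem2 {Ω : Type*} [MeasurableSpace Ω] (P : Measure Ω) [IsProbabilityMeasure P]
    (f : ℝ → ℝ) (hf : HARQ.IsChannelPdf f)
    (z : ℕ → Ω → ℝ) (hz : HARQ.IsEffectiveChannel P f z)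
    (Θ θ R : ℝ) (hΘ : 0 < Θ) (hθ : 0 < θ) (hR : 0 < R) :
    ∃ lam : ℝ, 0 < lam ∧ lam < 1 ∧
      -- `lam` is the limit of the spectral radii of the truncated schemes
      Tendsto (fun M : ℕ => spectralRadius ℂ (HARQ.companion P z Θ θ R M)) atTop
        (𝓝 (ENNReal.ofReal lam)) ∧
      -- the effective capacity of persistent HARQ exists and equals `-ln lam / θ`
      Tendsto (fun k : ℕ => HARQ.effCapacity P z Θ θ R k) atTop (𝓝 (-(Real.log lam) / θ)) ∧
      -- `lam` satisfies the implicit equation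
      ((Real.exp (θ * R) : ℝ) : ℂ) = HARQ.invLaplace (HARQ.kernel f lam) Θ ∧
      -- and is its only positive solution
      ∀ lam' : ℝ, 0 < lam' →
        ((Real.exp (θ * R) : ℝ) : ℂ) = HARQ.invLaplace (HARQ.kernel f lam') Θ → lam' = lam := by
  have hq := hz.isSurvival_Q hf hΘ
  have hc : 0 < θ * R := mul_pos hθ hR
  obtain ⟨lam, hlam, hlam1, h⟩ := hq.exists_lifeGen_eq (Real.one_lt_exp_iff.2 hc)
  have h' : HARQ.lifeGen (HARQ.Q P z Θ) lam⁻¹ = (Real.exp (-(θ * R)))⁻¹ := by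
    rw [h, Real.exp_neg, inv_inv]
  refine ⟨lam, hlam, hlam1, ?_, hz.tendsto_effCapacity hf hΘ hθ hR hlam h', ?_, ?_⟩
  · simp_rw [HARQ.companion_eq_rowCompanion]
    exact hq.tendsto_spectralRadius hlam hlam1 (Real.exp_pos _)
      (Real.exp_le_one_iff.2 (neg_nonpos.2 hc.le)) h'
  · rw [hz.invLaplace_kernel hf hlam hΘ, h]
  · intro lam' hlam' heq
    rw [hz.invLaplace_kernel hf hlam' hΘ, ← h] at heq
    exact hq.lifeGen_inv_injOn hlam' hlam (Complex.ofReal_injective heq).symm
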